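/- **Conventions.** Let $n\ge 1$, $[n]=\{1,\dots,n\}$, $\mathfrak S_n$ the symmetric group, $s_i=(i,i+1)$, $\ell(\sigma)$ the length, $\mathrm{Des}_L(\sigma)=\{i:\ell(s_i\sigma)<\ell(\sigma)\}$ and $\mathrm{Des}_R(\sigma)=\{i:\ell(\sigma s_i)<\ell(\sigma)\}$. The left (right) weak Bruhat order $\preceq_L$ ($\preceq_R$) is generated by $\sigma\preceq_L s_i\sigma$ for $i\notin\mathrm{Des}_L(\sigma)$ (by $\sigma\preceq_R\sigma s_i$ for $i\notin\mathrm{Des}_R(\sigma)$); if $\sigma\preceq_L\rho$, then $[\sigma,\rho]_L=\{\gamma:\sigma\preceq_L\gamma\preceq_L\rho\}$. For $S\subseteq[n-1]$, $w_0(S)$ is the longest element of the subgroup generated by $\{s_i: i\in S\}$, and $w_1(S)$ is the longest element of $\{z\in\mathfrak S_n:\mathrm{Des}_R(z)\subseteq S\}$. Two nonempty left weak Bruhat intervals are equivalent if there is an isomorphism $f$ between them (as posets under $\preceq_L$) with $\mathrm{Des}_L(f(\gamma))=\mathrm{Des}_L(\gamma)$ for all $\gamma$. Each equivalence class is ordered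 by $[\sigma,\rho]_L\preceq[\sigma',\rho']_L\iff\sigma\preceq_R\sigma'$. A *diagram* is a finite set of boxes $(x,y)$, with column $x\ge1$ counted from the left and row $y\ge1$ counted from the bottom. A *standard filling* $F$ of an $n$-box diagram $D$ uses each of $1,\dots,n$ once. Its poset $P_F$ on $[n]$ is given by $i\preceq j$ iff the box of $i$ is weakly left of and weakly below the box of $j$. For a poset $P$ on $[n]$ put $\Sigma_L(P)=\{\sigma\in\mathfrak S_n:\sigma(i)\le\sigma(j)\text{ whenever }i\preceq_P j\}$. $D^x$ and $F^x$ denote the reflections of $D$ and $F$ in the $x$-axis, shifted back upwards to start in row $1$. $\mathrm{ST}(D)$ is the set of standard fillings $T$ of $D$ with $T(i,j)\le T(k,l)$ whenever $i\le k$ and $j\le l$, ordered by $T\boldsymbol\le U$ iff $\mathrm{col}(T)\preceq_L\mathrm{col}(U)$, where $\mathrm{col}$ reads each column from top to bottom, starting with the leftmost column. Words containing each of $1,\dots,n$ once are regarded as permutations in one-line notation. Let $\alpha=(\alpha_1,\dots,\alpha_\ell)$ be a peak composition of $n$, i.e. $\alpha_i\ge1$, $\sum_i\alpha_i=n$, and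 $\alpha_i\ne1$ for $1\le i<\ell$. Put $\alpha^{\mathrm r}=(\alpha_\ell,\dots,\alpha_1)$, $\mathrm{set}(\alpha)=\{\alpha_1,\alpha_1+\alpha_2,\dots,\alpha_1+\cdots+\alpha_{\ell-1}\}$ and $2[k]=\{2,4,\dots,2k\}$. The diagram of $\alpha$ is left-justified with $\alpha_i$ boxes in row $i$. A *standard peak immaculate tableau* (SPIT) of shape $\alpha$ is a standard filling of this diagram whose rows increase from left to right and whose first column increases from bottom to top, such that for every $1\le k\le n$ the boxes with entries $\le k$ form the diagram of a peak composition. Define two SPITs of shape $\alpha$: * $\mathrm{source}_\alpha$ is filled with $1,\dots,n$ row by row, from bottom to top, from left to right in each row. * $\mathrm{sink}_\alpha$ has first column $1,3,\dots,2\ell-1$ and second column $2,4,6,\dots$ (both from bottom to top); the remaining numbers are placed consecutively in the remaining boxes, row by row from top to bottom, from left to right in each row. Let $\mathrm{read}$ be the reading word that reads each row from left to right, starting with the topmost row. Let $\mathrm{read}_{dr}$ be the reading word that reads the boxes $(1,1);\ (1,2),(2,1);\ (1,3),(2,2);\ \dots;\ (1,\ell),(2,\ell-1)$ in this order, and then the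 remaining boxes, row by row from top to bottom, from left to right in each row. Finally, let $\mathscr G$ be the diagram whose row $\ell$ is $\{(\ell+x-1,\ell):1\le x\le\alpha_\ell\}$ and whose row $j$, for $1\le j<\ell$, is $\{(j,j),(j+1,j)\}\cup\{(k_j+x,j):3\le x\le\alpha_j\}$, with $k_j=(\ell-1)+\sum_{j<r\le\ell}(\alpha_r-2)$. **Theorem.** Let $C$ be the equivalence class of $[\mathrm{read}(\mathrm{sink}_\alpha),w_1(\mathrm{set}(\alpha^{\mathrm r}))]_L$. (a) $C=\{\Sigma_L(P_{T^x}):T\in\mathrm{ST}(\mathscr G^x)\}$. Furthermore, $$\min C=[w_0(2[\ell-1]),\mathrm{read}_{dr}(\mathrm{source}_\alpha)]_L,\qquad \max C=[\mathrm{read}(\mathrm{sink}_\alpha),w_1(\mathrm{set}(\alpha^{\mathrm r}))]_L .$$ (b) $(C,\preceq)\cong(\mathrm{ST}(\mathscr G^x),\boldsymbol\le)$ as posets. -/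

import Mathlib

open Equiv

namespace PeakTab

/-! ### Symmetric groups and weak Bruhat orders

The set `[n] = {1, …, n}` is modelled by `Fin n`, the element `k : Fin n` standing for `k + 1`.
Indices of simple transpositions, descents and subsets of `[n-1]` are the usual 1-based natural
numbers. Products of permutations are compositions of functions. -/

/-- The set `[n-1] = {1, …, n-1}`. -/
def idx (n : ℕ) : Set ℕ := {i | 1 ≤ i ∧ i < n}

/-- The simple transposition `s_i = (i, i+1)` for `i ∈ [n-1]`
(and, by convention, the identity for all other `i`). -/
def simple (n i : ℕ) : Perm (Fin n) :=
  if h : 1 ≤ i ∧ i < n then swap ⟨i - 1, by omega⟩ ⟨i, h.2⟩ else 1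

/-- The length: the least number of simple transpositions in an expression of `σ`. -/
noncomputable def length {n : ℕ} (σ : Perm (Fin n)) : ℕ :=
  sInf {k | ∃ w : List ℕ, (∀ i ∈ w, i ∈ idx n) ∧ (w.map (simple n)).prod = σ ∧ w.length = k}

/-- Left descent set. -/
def desL {n : ℕ} (σ : Perm (Fin n)) : Set ℕ :=
  {i | i ∈ idx n ∧ length (simple n i * σ) < length σ}

/-- Right descent set. -/
def desR {n : ℕ} (σ : Perm (Fin n)) : Set ℕ :=
  {i | i ∈ idx n ∧ length (σ * simple n i) < length σ}

/-- Covering relation of the left weak Bruhat order. -/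
def coverL {n : ℕ} (σ τ : Perm (Fin n)) : Prop :=
  ∃ i ∈ idx n, i ∉ desL σ ∧ τ = simple n i * σ

/-- Covering relation of the right weak Bruhat order. -/
def coverR {n : ℕ} (σ τ : Perm (Fin n)) : Prop :=
  ∃ i ∈ idx n, i ∉ desR σ ∧ τ = σ * simple n i

/-- The left weak Bruhat order. -/
def weakL {n : ℕ} : Perm (Fin n) → Perm (Fin n) → Prop := Relation.ReflTransGen coverL

/-- The right weak Bruhat order. -/
def weakR {n : ℕ} : Perm (Fin n) → Perm (Fin n) → Prop := Relation.ReflTransGen coverR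

/-- The left weak Bruhat interval `[σ, ρ]_L`. -/
def intervalL {n : ℕ} (σ ρ : Perm (Fin n)) : Set (Perm (Fin n)) :=
  {γ | weakL σ γ ∧ weakL γ ρ}

/-- An element of maximal length in a nonempty set of permutations. -/
noncomputable def longestIn {n : ℕ} (A : Set (Perm (Fin n))) (hA : A.Nonempty) : Perm (Fin n) :=
  (Set.exists_max_image A length A.toFinite hA).choose

/-- The parabolic subgroup generated by the `s_i` with `i ∈ S`. -/
def parabolic (n : ℕ) (S : Set ℕ) : Subgroup (Perm (Fin n)) :=
  Subgroup.closure (simple n '' S)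

/-- `w_0(S)`, the longest element of the parabolic subgroup of `S`. -/
noncomputable def w0 (n : ℕ) (S : Set ℕ) : Perm (Fin n) :=
  longestIn (parabolic n S : Set (Perm (Fin n))) ⟨1, one_mem _⟩

/-- The minimal length representatives of the left cosets of the parabolic subgroup of `S`:
the permutations with all right descents in `[n-1] \ S`. -/
def minReps (n : ℕ) (S : Set ℕ) : Set (Perm (Fin n)) := {z | desR z ⊆ idx n \ S}

theorem length_one (n : ℕ) : length (1 : Perm (Fin n)) = 0 :=
  Nat.sInf_eq_zero.mpr (Or.inl ⟨[], by simp⟩)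

theorem one_mem_minReps (n : ℕ) (S : Set ℕ) : (1 : Perm (Fin n)) ∈ minReps n S := by
  rintro i ⟨-, h⟩
  rw [length_one] at h
  exact absurd h (Nat.not_lt_zero _)

/-- `w_1(T)`, the longest element among the minimal length representatives of the left cosets of
the parabolic subgroup of `[n-1] \ T`. -/
noncomputable def w1 (n : ℕ) (T : Set ℕ) : Perm (Fin n) :=
  longestIn (minReps n (idx n \ T)) ⟨1, one_mem_minReps n _⟩

/-! The left weak order is antisymmetric. -/

theorem exists_word {n : ℕ} (σ : Perm (Fin n)) :
    ∃ w : List ℕ, (∀ i ∈ w, i ∈ idx n) ∧ (w.map (simple n)).prod = σ := by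
  rcases n with _ | n
  · exact ⟨[], by simp, Subsingleton.elim _ _⟩
  · have h : σ ∈ Submonoid.closure (Set.range fun i : Fin n => swap i.castSucc i.succ) := by
      rw [Perm.mclosure_swap_castSucc_succ]; trivial
    induction h using Submonoid.closure_induction with
    | mem x hx =>
      obtain ⟨i, rfl⟩ := hx
      refine ⟨[i + 1], ?_, ?_⟩
      · simp [idx]
      · simp only [List.map_cons, List.map_nil, List.prod_cons, List.prod_nil, mul_one]
        rw [simple, dif_pos ⟨by omega, by omega⟩]
        rfl
    | one => exact ⟨[], by simp⟩
    | mul x y _ _ hx hy =>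
      obtain ⟨u, hu, rfl⟩ := hx
      obtain ⟨v, hv, rfl⟩ := hy
      refine ⟨u ++ v, ?_, by simp⟩
      intro i hi
      rcases List.mem_append.mp hi with h | h
      exacts [hu i h, hv i h]

theorem exists_word_length {n : ℕ} (σ : Perm (Fin n)) :
    ∃ w : List ℕ, (∀ i ∈ w, i ∈ idx n) ∧ (w.map (simple n)).prod = σ ∧ w.length = length σ := by
  obtain ⟨w, h1, h2⟩ := exists_word σ
  exact Nat.sInf_mem (s := {k | ∃ w : List ℕ, (∀ i ∈ w, i ∈ idx n) ∧
    (w.map (simple n)).prod = σ ∧ w.length = k}) ⟨w.length, w, h1, h2, rfl⟩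

theorem sign_simple {n i : ℕ} (h : i ∈ idx n) : Perm.sign (simple n i) = -1 := by
  rw [simple, dif_pos (show 1 ≤ i ∧ i < n from h)]
  apply Perm.sign_swap
  have := h.1
  simp only [ne_eq, Fin.mk.injEq]
  omega

theorem sign_eq {n : ℕ} (σ : Perm (Fin n)) : Perm.sign σ = (-1) ^ length σ := by
  obtain ⟨w, h1, rfl, h3⟩ := exists_word_length σ
  rw [← h3]
  clear h3
  induction w with
  | nil => simp
  | cons a w ih =>
    rw [List.map_cons, List.prod_cons, map_mul, sign_simple (h1 a (by simp)),
      ih (fun i hi => h1 i (by simp [hi])), List.length_cons, pow_succ']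

theorem coverL.length_lt {n : ℕ} {σ τ : Perm (Fin n)} (h : coverL σ τ) :
    length σ < length τ := by
  obtain ⟨i, hi, hd, rfl⟩ := h
  have h1 : length σ ≤ length (simple n i * σ) := by
    by_contra hlt
    exact hd ⟨hi, not_le.mp hlt⟩
  refine lt_of_le_of_ne h1 fun he => ?_
  have h2 := sign_eq (simple n i * σ)
  rw [map_mul, sign_simple hi, ← he, ← sign_eq σ] at h2
  rcases Int.units_eq_one_or (Perm.sign σ) with h | h <;> rw [h] at h2 <;> revert h2 <;> decide

theorem weakL.eq_or_length_lt {n : ℕ} {σ τ : Perm (Fin n)} (h : weakL σ τ) :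
    σ = τ ∨ length σ < length τ := by
  induction h with
  | refl => exact Or.inl rfl
  | tail _ h ih =>
    right
    rcases ih with rfl | ih
    exacts [h.length_lt, ih.trans h.length_lt]

theorem weakL_antisymm {n : ℕ} {σ τ : Perm (Fin n)} (h : weakL σ τ) (h' : weakL τ σ) : σ = τ := by
  rcases h.eq_or_length_lt with h | h
  · exact h
  rcases h'.eq_or_length_lt with h' | h'
  exacts [h'.symm, absurd h (lt_asymm h')]

/-! ### Descent-preserving equivalence of weak Bruhat intervals -/

/-- The set `Int(n)` of nonempty (left) weak Bruhat intervals. -/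
def Intervals (n : ℕ) : Set (Set (Perm (Fin n))) :=
  {I | ∃ σ ρ, weakL σ ρ ∧ I = intervalL σ ρ}

/-- There is a descent-preserving isomorphism between `I` and `J`, both ordered by the left
weak Bruhat order. -/
def DEquiv {n : ℕ} (I J : Set (Perm (Fin n))) : Prop :=
  ∃ f : I ≃ J, (∀ γ γ' : I, weakL γ.1 γ'.1 ↔ weakL (f γ).1 (f γ').1) ∧
    ∀ γ : I, desL γ.1 = desL (f γ).1

/-- The equivalence class of an interval in `Int(n)`. -/
def eqClass {n : ℕ} (I : Set (Perm (Fin n))) : Set (Set (Perm (Fin n))) :=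
  {J | J ∈ Intervals n ∧ DEquiv I J}

/-- `[σ, ρ]_L ≼ [σ', ρ']_L` if and only if `σ ≼_R σ'`. -/
def intervalLE {n : ℕ} (I J : Set (Perm (Fin n))) : Prop :=
  ∃ σ ρ σ' ρ', weakL σ ρ ∧ weakL σ' ρ' ∧ I = intervalL σ ρ ∧ J = intervalL σ' ρ' ∧ weakR σ σ'

instance {n : ℕ} (I : Set (Perm (Fin n))) : LE (eqClass I) := ⟨fun J K => intervalLE J.1 K.1⟩

/-- `I` is the minimum of `C` with respect to `≼`. -/
def IsMinOf {n : ℕ} (I : Set (Perm (Fin n))) (C : Set (Set (Perm (Fin n)))) : Prop :=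
  I ∈ C ∧ ∀ J ∈ C, intervalLE I J

/-- `I` is the maximum of `C` with respect to `≼`. -/
def IsMaxOf {n : ℕ} (I : Set (Perm (Fin n))) (C : Set (Set (Perm (Fin n)))) : Prop :=
  I ∈ C ∧ ∀ J ∈ C, intervalLE J I

/-- `Σ_L(P)` for a poset `P` with ground set `[n]`. -/
def sigmaL {n : ℕ} (P : PartialOrder (Fin n)) : Set (Perm (Fin n)) :=
  {σ | ∀ i j, P.le i j → σ i ≤ σ j}

/-! ### Diagrams, fillings and reading words

A diagram is a finite set of boxes `(x, y)`, where `x` is the column (from the left) and `y` the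
row (from the bottom), both starting from `1`. -/

abbrev Diagram := Finset (ℕ × ℕ)

/-- Standard fillings: the entries `1, …, n` are each used exactly once. -/
abbrev Filling (n : ℕ) (D : Diagram) := {b // b ∈ D} ≃ Fin n

theorem Filling.card_eq {n : ℕ} {D : Diagram} (F : Filling n D) : D.card = n := by
  have := Fintype.card_congr F
  simpa using this

/-- The poset `P_F`: `i ≼ j` if and only if the box of `i` is weakly left of and weakly below the
box of `j`. -/
@[reducible] def posetOf {n : ℕ} {D : Diagram} (F : Filling n D) : PartialOrder (Fin n) :=
  PartialOrder.lift (fun i => (F.symm i).1) (Subtype.val_injective.comp F.symm.injective)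

/-- The list of the `n` boxes of `D`, in increasing order of `key`. -/
def enum {K : Type*} [LinearOrder K] (key : ℕ × ℕ → K) (hkey : Function.Injective key)
    {n : ℕ} {D : Diagram} (hD : D.card = n) : Fin n ≃ {b // b ∈ D} :=
  (@Finset.orderIsoOfFin _ (LinearOrder.lift' key hkey) D n hD).toEquiv

theorem orderIsoOfFin_symm_lt_iff {A : Type*} [LinearOrder A] (D : Finset A) {n : ℕ}
    (hD : D.card = n) (b b' : {b // b ∈ D}) :
    (D.orderIsoOfFin hD).symm b < (D.orderIsoOfFin hD).symm b' ↔ b.1 < b'.1 :=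
  (D.orderIsoOfFin hD).symm.lt_iff_lt

theorem enum_symm_lt_iff {K : Type*} [LinearOrder K] (key : ℕ × ℕ → K)
    (hkey : Function.Injective key) {n : ℕ} {D : Diagram} (hD : D.card = n) (b b' : {b // b ∈ D}) :
    (enum key hkey hD).symm b < (enum key hkey hD).symm b' ↔ key b.1 < key b'.1 :=
  @orderIsoOfFin_symm_lt_iff _ (LinearOrder.lift' key hkey) D n hD b b'

/-- The word of the entries of `F`, read in increasing order of the keys of the boxes,
as a permutation `k ↦ k`-th letter. -/
def readBy {K : Type*} [LinearOrder K] (key : ℕ × ℕ → K) (hkey : Function.Injective key)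
    {n : ℕ} {D : Diagram} (F : Filling n D) : Perm (Fin n) :=
  (enum key hkey F.card_eq).trans F

theorem readBy_injective {K : Type*} [LinearOrder K] (key : ℕ × ℕ → K)
    (hkey : Function.Injective key) {n : ℕ} {D : Diagram} :
    Function.Injective (readBy key hkey : Filling n D → Perm (Fin n)) := by
  intro F G h
  ext b
  have := congrArg (fun e : Perm (Fin n) => e ((enum key hkey F.card_eq).symm b)) h
  simpa [readBy] using congrArg Fin.val this

/-- Columns from left to right, each from top to bottom. -/
def keyTBLR (b : ℕ × ℕ) : ℕ ×ₗ ℕᵒᵈ := toLex (b.1, OrderDual.toDual b.2)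

/-- Rows from top to bottom, each from left to right. -/
def keyLRTB (b : ℕ × ℕ) : ℕᵒᵈ ×ₗ ℕ := toLex (OrderDual.toDual b.2, b.1)

theorem keyTBLR_injective : Function.Injective keyTBLR := by
  rintro ⟨a, b⟩ ⟨c, d⟩ h
  simpa [keyTBLR] using h

theorem keyLRTB_injective : Function.Injective keyLRTB := by
  rintro ⟨a, b⟩ ⟨c, d⟩ h
  have := congrArg ofLex h
  simp only [keyLRTB, ofLex_toLex, Prod.mk.injEq, OrderDual.toDual_inj] at this
  simp [this]

/-- The reading word from top to bottom in each column, starting with the leftmost column. -/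
def readTBLR {n : ℕ} {D : Diagram} (F : Filling n D) : Perm (Fin n) :=
  readBy keyTBLR keyTBLR_injective F

/-- The reading word from left to right in each row, starting with the topmost row. -/
def readLRTB {n : ℕ} {D : Diagram} (F : Filling n D) : Perm (Fin n) :=
  readBy keyLRTB keyLRTB_injective F

/-- `ST(D)`: standard tableaux on `D`. -/
def ST (n : ℕ) (D : Diagram) : Type :=
  {T : Filling n D // ∀ b b' : {b // b ∈ D}, b.1.1 ≤ b'.1.1 → b.1.2 ≤ b'.1.2 → T b ≤ T b'}

/-- `T ≤ U` if and only if the column reading word of `T` is below that of `U` in the left weak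
Bruhat order. -/
instance (n : ℕ) (D : Diagram) : PartialOrder (ST n D) where
  le T U := weakL (readTBLR T.1) (readTBLR U.1)
  le_refl _ := Relation.ReflTransGen.refl
  le_trans _ _ _ h h' := Relation.ReflTransGen.trans h h'
  le_antisymm _ _ h h' := Subtype.ext (readBy_injective _ _ (weakL_antisymm h h'))

/-- The index of the topmost row. -/
def topRow (D : Diagram) : ℕ := D.sup Prod.snd

/-- `D^x`: the reflection of `D` in the `x`-axis, shifted to the rows `1, …, topRow D`. -/
def reflX (D : Diagram) : Diagram := D.image fun b => (b.1, topRow D + 1 - b.2)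

theorem reflX_injOn (D : Diagram) :
    Set.InjOn (fun b : ℕ × ℕ => (b.1, topRow D + 1 - b.2)) (D : Set (ℕ × ℕ)) := by
  rintro ⟨a, b⟩ h ⟨c, d⟩ h' he
  have h1 : b ≤ topRow D := Finset.le_sup (f := Prod.snd) h
  have h2 : d ≤ topRow D := Finset.le_sup (f := Prod.snd) h'
  simp only [Prod.mk.injEq] at he ⊢
  omega

/-- The bijection from the boxes of `D` to the boxes of `D^x`. -/
noncomputable def reflXEquiv (D : Diagram) : {b // b ∈ D} ≃ {b // b ∈ reflX D} :=
  Equiv.ofBijective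
    (fun b => ⟨(b.1.1, topRow D + 1 - b.1.2), Finset.mem_image_of_mem _ b.2⟩)
    ⟨fun b b' h => Subtype.ext (reflX_injOn D b.2 b'.2 (congrArg Subtype.val h)), by
      rintro ⟨c, hc⟩
      obtain ⟨b, hb, rfl⟩ := Finset.mem_image.mp hc
      exact ⟨⟨b, hb⟩, rfl⟩⟩

/-- `F^x`: the reflection of a filling in the `x`-axis. -/
noncomputable def Filling.reflX {n : ℕ} {D : Diagram} (F : Filling n D) :
    Filling n (PeakTab.reflX D) :=
  (reflXEquiv D).symm.trans F

/-! ### Compositions and standard peak immaculate tableaux -/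

/-- The `i`-th part `α_i`, for `1 ≤ i ≤ ℓ(α)`. -/
def part {n : ℕ} (α : Composition n) (i : ℕ) : ℕ := α.blocks.getD (i - 1) 0

/-- `set(α) = {α_1, α_1 + α_2, …, α_1 + ⋯ + α_{ℓ(α)-1}}`. -/
def compSet {n : ℕ} (α : Composition n) : Set ℕ :=
  {m | ∃ j, 1 ≤ j ∧ j < α.length ∧ m = ∑ i ∈ Finset.Icc 1 j, part α i}

/-- `α` is a peak composition: `α_i ≠ 1` for `1 ≤ i < ℓ(α)`. -/
def IsPeak {n : ℕ} (α : Composition n) : Prop := ∀ i, 1 ≤ i → i < α.length → part α i ≠ 1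

/-- The composition diagram: left-justified, with `α_i` boxes in the `i`-th row from the bottom. -/
def cd {n : ℕ} (α : Composition n) : Diagram :=
  (Finset.Icc 1 α.length).biUnion fun i => (Finset.Icc 1 (part α i)).image fun x => (x, i)

theorem mem_cd {n : ℕ} (α : Composition n) (b : ℕ × ℕ) :
    b ∈ cd α ↔ (1 ≤ b.2 ∧ b.2 ≤ α.length) ∧ 1 ≤ b.1 ∧ b.1 ≤ part α b.2 := by
  obtain ⟨x, i⟩ := b
  simp only [cd, Finset.mem_biUnion, Finset.mem_image, Finset.mem_Icc, Prod.mk.injEq]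
  constructor
  · rintro ⟨j, hj, y, hy, rfl, rfl⟩
    exact ⟨hj, hy⟩
  · rintro ⟨hj, hy⟩
    exact ⟨i, hj, x, hy, rfl, rfl⟩

theorem part_succ {n : ℕ} (α : Composition n) (i : ℕ) : part α (i + 1) = α.blocks.getD i 0 := rfl

theorem card_cd {n : ℕ} (α : Composition n) : (cd α).card = n := by
  rw [cd, Finset.card_biUnion]
  · have h : ∀ i ∈ Finset.Icc 1 α.length,
        ((Finset.Icc 1 (part α i)).image fun x => (x, i)).card = part α i := by
      intro i _
      rw [Finset.card_image_of_injective _ (fun x y h => (Prod.mk.inj h).1)]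
      simp
    rw [Finset.sum_congr rfl h, ← Finset.Ico_add_one_right_eq_Icc, Finset.sum_Ico_eq_sum_range]
    have h2 : ∑ k ∈ Finset.range (α.length + 1 - 1), part α (1 + k) = α.blocks.sum := by
      rw [Nat.add_sub_cancel, ← Fin.sum_univ_eq_sum_range (fun k => part α (1 + k)),
        ← Fin.sum_univ_getElem]
      refine Finset.sum_congr rfl fun k _ => ?_
      rw [add_comm, part_succ, List.getD_eq_getElem]
    rw [h2, α.blocks_sum]
  · intro i _ j _ hij
    rw [Function.onFun, Finset.disjoint_left]
    intro b hb hb'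
    simp only [Finset.mem_image] at hb hb'
    obtain ⟨x, -, rfl⟩ := hb
    obtain ⟨y, -, h⟩ := hb'
    exact hij (Prod.mk.inj h).2.symm

/-- Standard immaculate tableaux of shape `α`: the entries increase from left to right in each row
and from bottom to top in the first column. -/
structure SIT {n : ℕ} (α : Composition n) where
  filling : Filling n (cd α)
  row_lt : ∀ b b' : {b // b ∈ cd α}, b.1.2 = b'.1.2 → b.1.1 < b'.1.1 → filling b < filling b'
  col_lt : ∀ b b' : {b // b ∈ cd α}, b.1.1 = 1 → b'.1.1 = 1 → b.1.2 < b'.1.2 →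
    filling b < filling b'

/-- Standard peak immaculate tableaux of shape `α`: for `1 ≤ k ≤ n`, the boxes with entries at most
`k` form the diagram of a peak composition. (An entry `v : Fin n` stands for `v + 1`.) -/
structure SPIT {n : ℕ} (α : Composition n) extends SIT α where
  peak : ∀ k, 1 ≤ k → k ≤ n → ∃ β : Composition k, IsPeak β ∧
    ∀ b, b ∈ cd β ↔ ∃ h : b ∈ cd α, (filling ⟨b, h⟩ : ℕ) + 1 ≤ k

theorem exists_bound (P : ℕ → Prop) (N : ℕ) (hP : ∀ x, P x → 1 ≤ x ∧ x ≤ N)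
    (hd : ∀ x, 1 ≤ x → P (x + 1) → P x) : ∃ r, ∀ x, P x ↔ 1 ≤ x ∧ x ≤ r := by
  classical
  have hdown : ∀ y x, 1 ≤ x → P (x + y) → P x := by
    intro y
    induction y with
    | zero => exact fun x _ h => h
    | succ y ih => exact fun x hx h => ih x hx (hd (x + y) (by omega) h)
  by_cases h : ∃ x, P x
  · obtain ⟨x, hx⟩ := h
    refine ⟨Nat.findGreatest P N, fun y => ⟨fun hy => ⟨(hP y hy).1,
      Nat.le_findGreatest (hP y hy).2 hy⟩, fun hy => ?_⟩⟩
    have h2 : P (Nat.findGreatest P N) := Nat.findGreatest_spec (hP x hx).2 hx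
    exact hdown (Nat.findGreatest P N - y) y hy.1 (by rwa [Nat.add_sub_cancel' hy.2])
  · exact ⟨0, fun y => ⟨fun hy => absurd ⟨y, hy⟩ h, fun hy => by omega⟩⟩

/-- An SIT in which the second entry of each row, other than the last, is smaller than
the first entry of the next row is an SPIT. -/
theorem SIT.peak_of {n : ℕ} {α : Composition n} (T : SIT α)
    (hT : ∀ i, 1 ≤ i → ∀ h' : (1, i + 1) ∈ cd α, ∃ h : (2, i) ∈ cd α,
      T.filling ⟨(2, i), h⟩ < T.filling ⟨(1, i + 1), h'⟩)
    (k : ℕ) (hk : k ≤ n) : ∃ β : Composition k, IsPeak β ∧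
    ∀ b, b ∈ cd β ↔ ∃ h : b ∈ cd α, (T.filling ⟨b, h⟩ : ℕ) + 1 ≤ k := by
  classical
  let P : ℕ → ℕ → Prop := fun i x => ∃ h : (x, i) ∈ cd α, (T.filling ⟨(x, i), h⟩ : ℕ) + 1 ≤ k
  have hrow : ∀ i x, 1 ≤ x → P i (x + 1) → P i x := by
    rintro i x hx ⟨h, hle⟩
    have h0 : (x, i) ∈ cd α := by
      rw [mem_cd] at h ⊢
      simp only at h ⊢
      omega
    have := T.row_lt ⟨(x, i), h0⟩ ⟨(x + 1, i), h⟩ rfl (Nat.lt_succ_self x)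
    exact ⟨h0, by rw [Fin.lt_def] at this; omega⟩
  have hnext : ∀ i, 1 ≤ i → P (i + 1) 1 → P i 2 := by
    rintro i hi ⟨h, hle⟩
    obtain ⟨h0, h1⟩ := hT i hi h
    exact ⟨h0, by rw [Fin.lt_def] at h1; omega⟩
  have hex : ∀ i, ∃ r, ∀ x, P i x ↔ 1 ≤ x ∧ x ≤ r := fun i =>
    exists_bound (P i) (part α i) (fun x h => ((mem_cd α _).mp h.1).2) (hrow i)
  choose r hr using hex
  obtain ⟨m, hm⟩ := exists_bound (fun i => P i 1) α.length
    (fun i h => ((mem_cd α _).mp h.1).1) (fun i hi h => hrow i 1 le_rfl (hnext i hi h))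
  let bl : List ℕ := (List.range m).map fun i => r (i + 1)
  have hlen : bl.length = m := by simp [bl]
  have hpos : ∀ {i}, i ∈ bl → 0 < i := by
    intro i hi
    obtain ⟨j, hj, rfl⟩ := List.mem_map.mp hi
    have := List.mem_range.mp hj
    have := (hr (j + 1) 1).mp ((hm (j + 1)).mpr ⟨by omega, by omega⟩)
    omega
  have hget : ∀ i, 1 ≤ i → i ≤ m → bl.getD (i - 1) 0 = r i := by
    intro i h1 h2
    rw [List.getD_eq_getElem _ _ (by omega)]
    simp [bl, Nat.sub_add_cancel h1]
  have hmem : ∀ (N : ℕ) (β : Composition N), β.blocks = bl →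
      ∀ b : ℕ × ℕ, b ∈ cd β ↔ ∃ h : b ∈ cd α, (T.filling ⟨b, h⟩ : ℕ) + 1 ≤ k := by
    rintro N β hβ ⟨x, i⟩
    rw [mem_cd]
    change _ ↔ P i x
    rw [hr i x, part, hβ, Composition.length, hβ, hlen]
    simp only
    constructor
    · rintro ⟨⟨h1, h2⟩, h3, h4⟩
      rw [hget i h1 h2] at h4
      exact ⟨h3, h4⟩
    · rintro ⟨h3, h4⟩
      have h5 : P i 1 := (hr i 1).mpr ⟨le_rfl, h3.trans h4⟩
      have h6 := (hm i).mp h5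
      exact ⟨h6, h3, by rwa [hget i h6.1 h6.2]⟩
  have hsum : bl.sum = k := by
    let β : Composition bl.sum := ⟨bl, hpos, rfl⟩
    have h1 : cd β = (Finset.univ.filter fun v : Fin n => (v : ℕ) + 1 ≤ k).map
        (T.filling.symm.toEmbedding.trans (Function.Embedding.subtype _)) := by
      ext b
      rw [hmem _ β rfl b, Finset.mem_map]
      constructor
      · rintro ⟨h, hle⟩
        exact ⟨T.filling ⟨b, h⟩, by simpa using hle, by simp⟩
      · rintro ⟨v, hv, rfl⟩
        refine ⟨(T.filling.symm v).2, ?_⟩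
        simpa using hv
    have h2 := congrArg Finset.card h1
    rw [card_cd, Finset.card_map] at h2
    rw [h2]
    have h3 : (Finset.univ.filter fun v : Fin n => (v : ℕ) + 1 ≤ k).card
        = (Finset.range k).card := by
      refine Finset.card_bij (fun v _ => (v : ℕ)) ?_ ?_ ?_
      · intro v hv
        simpa [Nat.succ_le_iff] using hv
      · intro v _ w _ h
        exact Fin.ext h
      · intro v hv
        have := Finset.mem_range.mp hv
        exact ⟨⟨v, by omega⟩, by simpa [Nat.succ_le_iff] using this, rfl⟩
    rw [h3, Finset.card_range]
  refine ⟨⟨bl, hpos, hsum⟩, ?_, hmem k ⟨bl, hpos, hsum⟩ rfl⟩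
  intro i h1 h2
  change i < bl.length at h2
  change bl.getD (i - 1) 0 ≠ 1
  rw [hlen] at h2
  rw [hget i h1 h2.le]
  have := (hr i 2).mp (hnext i h1 ((hm (i + 1)).mpr ⟨by omega, by omega⟩))
  omega

/-- For a peak composition, every row except possibly the last has at least two boxes. -/
theorem IsPeak.two_mem {n : ℕ} {α : Composition n} (hα : IsPeak α) {i : ℕ} (hi : 1 ≤ i)
    (h : (1, i + 1) ∈ cd α) : (2, i) ∈ cd α := by
  rw [mem_cd] at h ⊢
  simp only at h ⊢
  have h1 := hα i hi (by omega)
  have h2 : 0 < part α i := by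
    rw [part, List.getD_eq_getElem _ _ (show i - 1 < α.blocks.length by
      rw [Composition.blocks_length]; omega)]
    exact α.blocks_pos' _ _
  omega

/-- Place the entries `1, …, n` into the boxes in increasing order of `key`. -/
def fillBy {K : Type*} [LinearOrder K] (key : ℕ × ℕ → K) (hkey : Function.Injective key)
    {n : ℕ} {D : Diagram} (hD : D.card = n) : Filling n D := (enum key hkey hD).symm

/-- First the two leftmost columns, row by row from bottom to top and from left to right in each
row; then the remaining boxes, row by row from top to bottom and from left to right. -/
def keySink (b : ℕ × ℕ) : ℕ ×ₗ ℤ ×ₗ ℕ :=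
  if b.1 ≤ 2 then toLex (0, toLex ((b.2 : ℤ), b.1)) else toLex (1, toLex (-(b.2 : ℤ), b.1))

/-- Rows from bottom to top, each from left to right. -/
def keySource (b : ℕ × ℕ) : ℕ ×ₗ ℕ := toLex (b.2, b.1)

theorem keySink_injective : Function.Injective keySink := by
  rintro ⟨a, b⟩ ⟨c, d⟩ h
  unfold keySink at h
  split_ifs at h <;> simp at h <;> simp [h]

theorem keySource_injective : Function.Injective keySource := by
  rintro ⟨a, b⟩ ⟨c, d⟩ h
  simp [keySource] at h
  simp [h]

/-- The sink tableau of shape `α`. As all rows but the last have at least two boxes, its first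
column is `1, 3, …, 2ℓ(α) - 1` and its second column is `2, 4, …`, both from bottom to top; the
remaining numbers are placed consecutively in the remaining boxes, the rows being filled from top
to bottom, and each row from left to right. -/
def sinkSPIT {n : ℕ} (α : Composition n) (hα : IsPeak α) : SPIT α :=
  let T : SIT α :=
    { filling := fillBy keySink keySink_injective (card_cd α)
      row_lt := by
        rintro ⟨⟨a, b⟩, h⟩ ⟨⟨c, d⟩, h'⟩ hy hx
        rw [fillBy, enum_symm_lt_iff]
        simp only at hy hx ⊢
        subst hy
        unfold keySink
        simp only
        split_ifs <;> simp [Prod.Lex.toLex_lt_toLex] <;> omega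
      col_lt := by
        rintro ⟨⟨a, b⟩, h⟩ ⟨⟨c, d⟩, h'⟩ hx hx' hy
        rw [fillBy, enum_symm_lt_iff]
        simp only at hy hx hx' ⊢
        subst hx hx'
        simp [keySink, Prod.Lex.toLex_lt_toLex]
        omega }
  { T with
    peak := fun k _ hk => T.peak_of (fun i hi h' => ⟨hα.two_mem hi h', by
      change fillBy _ _ _ _ < fillBy _ _ _ _
      rw [fillBy, enum_symm_lt_iff]
      simp [keySink, Prod.Lex.toLex_lt_toLex]⟩) k hk }

/-- The source tableau of shape `α`: the entries `1, …, n` are placed consecutively in the rows,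
from bottom to top, and from left to right in each row. -/
def sourceSPIT {n : ℕ} (α : Composition n) (hα : IsPeak α) : SPIT α :=
  let T : SIT α :=
    { filling := fillBy keySource keySource_injective (card_cd α)
      row_lt := by
        rintro ⟨⟨a, b⟩, h⟩ ⟨⟨c, d⟩, h'⟩ hy hx
        rw [fillBy, enum_symm_lt_iff]
        simp only at hy hx ⊢
        subst hy
        simp [keySource, Prod.Lex.toLex_lt_toLex, hx]
      col_lt := by
        rintro ⟨⟨a, b⟩, h⟩ ⟨⟨c, d⟩, h'⟩ hx hx' hy
        rw [fillBy, enum_symm_lt_iff]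
        simp only at hy hx hx' ⊢
        subst hx hx'
        simp [keySource, Prod.Lex.toLex_lt_toLex, hy] }
  { T with
    peak := fun k _ hk => T.peak_of (fun i hi h' => ⟨hα.two_mem hi h', by
      change fillBy _ _ _ _ < fillBy _ _ _ _
      rw [fillBy, enum_symm_lt_iff]
      simp [keySource, Prod.Lex.toLex_lt_toLex]⟩) k hk }

/-- The order of boxes, in a diagram with `l` rows, for the diagonal reading: first
`(1,1); (1,2), (2,1); (1,3), (2,2); …; (1,l), (2,l-1)`, then the remaining boxes, rows from top to
bottom and each row from left to right. -/
def keyDr (l : ℕ) (b : ℕ × ℕ) : ℕ ×ₗ ℤ ×ₗ ℕ :=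
  if b.1 = 1 ∨ (b.1 = 2 ∧ b.2 < l) then toLex (0, toLex ((b.1 : ℤ) + b.2, b.1))
  else toLex (1, toLex (-(b.2 : ℤ), b.1))

theorem keyDr_injective (l : ℕ) : Function.Injective (keyDr l) := by
  rintro ⟨a, b⟩ ⟨c, d⟩ h
  unfold keyDr at h
  split_ifs at h <;> simp at h <;> simp <;> omega

/-- The diagonal reading word of an SPIT. -/
def readDr {n : ℕ} {α : Composition n} (T : SPIT α) : Perm (Fin n) :=
  readBy (keyDr α.length) (keyDr_injective α.length) T.filling

/-- `k_j = (ℓ(α) - 1) + ∑_{j < r ≤ ℓ(α)} (α_r - 2)` for `j < ℓ(α)`. -/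
def kShift {n : ℕ} (α : Composition n) (j : ℕ) : ℤ :=
  ((α.length : ℤ) - 1) + ∑ r ∈ Finset.Ioc j α.length, ((part α r : ℤ) - 2)

/-- The diagram `𝒢`, row by row. -/
def diagramG {n : ℕ} (α : Composition n) : Diagram :=
  (Finset.Icc 1 α.length).biUnion fun j =>
    if j = α.length then (Finset.Icc 1 (part α j)).image fun x => (j + x - 1, j)
    else {(j, j), (j + 1, j)} ∪
      (Finset.Icc 3 (part α j)).image fun x : ℕ => ((kShift α j + x).toNat, j)

/-- `2[k] = {2, 4, …, 2k}`. -/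
def evens (k : ℕ) : Set ℕ := {m | ∃ j, 1 ≤ j ∧ j ≤ k ∧ m = 2 * j}

/-- The interval `[read(sink), w_1(set(α^r))]_L`, where `read` is the reading word from left to
right in each row, starting with the topmost row. -/
noncomputable def sinkInterval {n : ℕ} (α : Composition n) (hα : IsPeak α) :
    Set (Perm (Fin n)) :=
  intervalL (readLRTB (sinkSPIT α hα).filling) (w1 n (compSet α.reverse))

/-- The interval `[w_0(2[ℓ(α)-1]), read_dr(source)]_L`. -/
noncomputable def sourceInterval {n : ℕ} (α : Composition n) (hα : IsPeak α) :
    Set (Perm (Fin n)) :=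
  intervalL (w0 n (evens (α.length - 1))) (readDr (sourceSPIT α hα))

end PeakTab

namespace PeakTab

/-! ### Inversions -/

/-! Every interval in the class is the set of linear extensions of one fixed poset on the boxes of
the diagram of $\alpha$, written as words. The poset is the tree order `treeLE`. A numbering
$\omega$ of the boxes fixes the positions, a filling $S$ fixes the letters, and the word is
$S\circ\omega^{-1}$. The only freedom is $\omega$, and the class consists of the sets `linExt ω` for
$\omega$ increasing along `labelLE`.

For such a labeling, `linExt_eq_intervalL` shows that `linExt ω` is an interval from the sink word
to the source word. Changing $\omega$ is right multiplication by a fixed permutation. It preserves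
the left weak order and left descents, because these only involve the label order of boxes that are
incomparable or consecutive, and `labelLE` fixes that order (`DEquiv_linExt`). Conversely, a
descent-preserving isomorphism must be right multiplication (`descentIso_apply`): descent sets
reveal which generator labels each cover. So any member of the class comes from some $\omega$.
Testing descents on extensions that make two given boxes adjacent
(`exists_linear_extension_consecutive`) forces $\omega$ to respect `labelLE`
(`exists_labeling_of_DEquiv`).

The diagram $\mathscr G$ is a planar picture of both relations: `treeLE` is its south-west order
(`treeLE_iff`) and `labelLE` its north-west order (`labelLE_iff`), which becomes south-west in
$\mathscr G^x$. Hence labelings are the tableaux in $\mathrm{ST}(\mathscr G^x)$. The column reading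
of $\mathscr G^x$ visits boxes in sink order (`keySink_lt_iff`), so comparing column words on the
left is the same as comparing bottoms of intervals on the right. The extremes come from the diagonal
numbering, which inverts the sink order only where `labelLE` forces it, and the row numbering, which
inverts it wherever `labelLE` permits. -/

/-- The inversion set, as pairs of positions. -/
def invSet {n : ℕ} (σ : Perm (Fin n)) : Finset (Fin n × Fin n) :=
  Finset.univ.filter fun p => p.1 < p.2 ∧ σ p.2 < σ p.1

theorem mem_invSet {n : ℕ} {σ : Perm (Fin n)} {p q : Fin n} :
    (p, q) ∈ invSet σ ↔ p < q ∧ σ q < σ p := by simp [invSet]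

/-- Offset convention for what follows: the 1-based index $i$ exchanges the 0-based values $i-1$ and
$i$, so the index equals the larger of the two adjacent values, read as a natural number. -/
theorem mem_idx_iff {n i : ℕ} :
    i ∈ idx n ↔ ∃ a b : Fin n, (a : ℕ) + 1 = b ∧ (b : ℕ) = i := by
  constructor
  · rintro ⟨h1, h2⟩
    exact ⟨⟨i - 1, by omega⟩, ⟨i, h2⟩, by simp only; omega, rfl⟩
  · rintro ⟨a, b, h, rfl⟩
    exact ⟨by omega, b.2⟩

theorem mem_idx {n : ℕ} {a b : Fin n} (h : (a : ℕ) + 1 = b) : (b : ℕ) ∈ idx n :=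
  mem_idx_iff.mpr ⟨a, b, h, rfl⟩

theorem simple_eq_swap {n : ℕ} {a b : Fin n} (h : (a : ℕ) + 1 = b) :
    simple n b = swap a b := by
  rw [simple, dif_pos ⟨by omega, b.2⟩]
  congr 1
  exact Fin.ext (by simp only; omega)

theorem simple_mul_simple (n i : ℕ) : simple n i * simple n i = 1 := by
  unfold simple
  split_ifs <;> simp

theorem simple_mul_cancel {n : ℕ} (i : ℕ) (σ : Perm (Fin n)) :
    simple n i * (simple n i * σ) = σ := by
  rw [← mul_assoc, simple_mul_simple, one_mul]

theorem simple_inv (n i : ℕ) : (simple n i)⁻¹ = simple n i :=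
  inv_eq_of_mul_eq_one_right (simple_mul_simple n i)

theorem swap_lt_swap {n : ℕ} {a b u v : Fin n} (h : (a : ℕ) + 1 = b) (huv : u < v)
    (hne : ¬(u = a ∧ v = b)) : swap a b u < swap a b v := by
  simp only [swap_apply_def, Fin.ext_iff, Fin.lt_def] at *
  split_ifs <;> omega

/-- Adjacent values compare alike with every third value, so exchanging them changes only the
relative order of their own two positions. -/
theorem invSet_swap_mul {n : ℕ} {a b : Fin n} (h : (a : ℕ) + 1 = b) {σ : Perm (Fin n)}
    (hσ : σ.symm a < σ.symm b) :
    invSet (swap a b * σ) = insert (σ.symm a, σ.symm b) (invSet σ) := by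
  ext ⟨p, q⟩
  rw [Finset.mem_insert, mem_invSet, mem_invSet, Perm.mul_apply, Perm.mul_apply, Prod.mk.injEq,
    eq_symm_apply, eq_symm_apply]
  have hab : a < b := by rw [Fin.lt_def]; omega
  by_cases h1 : σ p = a ∧ σ q = b
  · obtain ⟨rfl, rfl⟩ := h1
    simp only [symm_apply_apply] at hσ
    simp [hσ, hab]
  by_cases h2 : σ q = a ∧ σ p = b
  · obtain ⟨rfl, rfl⟩ := h2
    simp only [symm_apply_apply] at hσ
    simp [hσ.not_gt, hab.ne']
  simp only [h1, false_or]
  refine and_congr_right fun hpq => ⟨fun hlt => ?_, fun hlt => swap_lt_swap h hlt h2⟩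
  rcases lt_trichotomy (σ q) (σ p) with h3 | h3 | h3
  · exact h3
  · exact absurd (σ.injective h3) hpq.ne'
  · exact absurd hlt (swap_lt_swap h h3 h1).not_gt

theorem card_invSet_swap_mul {n : ℕ} {a b : Fin n} (h : (a : ℕ) + 1 = b) {σ : Perm (Fin n)}
    (hσ : σ.symm a < σ.symm b) : (invSet (swap a b * σ)).card = (invSet σ).card + 1 := by
  rw [invSet_swap_mul h hσ, Finset.card_insert_of_notMem]
  rw [mem_invSet]
  simp only [apply_symm_apply, not_and, not_lt, Fin.le_def]
  omega

theorem card_invSet_of_descent {n : ℕ} {a b : Fin n} (h : (a : ℕ) + 1 = b) {σ : Perm (Fin n)}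
    (hσ : σ.symm b < σ.symm a) : (invSet σ).card = (invSet (swap a b * σ)).card + 1 := by
  rw [← card_invSet_swap_mul h, ← mul_assoc, swap_mul_self, one_mul]
  change σ.symm ((swap a b).symm a) < σ.symm ((swap a b).symm b)
  simpa using hσ

theorem eq_one_of_lt_succ {n : ℕ} {σ : Perm (Fin n)}
    (h : ∀ a b : Fin n, (a : ℕ) + 1 = b → σ a < σ b) : σ = 1 := by
  rcases n with _ | n
  · exact Subsingleton.elim _ _
  have h1 : StrictMono σ := Fin.strictMono_iff_lt_succ.mpr fun i => h _ _ (by simp)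
  have h2 := Subsingleton.elim (h1.orderIsoOfSurjective _ σ.surjective) (OrderIso.refl _)
  ext x
  exact congrArg Fin.val (DFunLike.congr_fun h2 x)

theorem length_simple_mul_le {n i : ℕ} (hi : i ∈ idx n) (σ : Perm (Fin n)) :
    length (simple n i * σ) ≤ length σ + 1 := by
  obtain ⟨w, h1, h2, h3⟩ := exists_word_length σ
  rw [← h3]
  refine Nat.sInf_le ⟨i :: w, ?_, by simp [h2], rfl⟩
  simp only [List.mem_cons, forall_eq_or_imp]
  exact ⟨hi, h1⟩

/-- A permutation without left descents is the identity, so removing descents one at a time gives a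
word with as many letters as inversions. In the other direction, each letter of a word adds at most
one inversion. -/
theorem length_eq_card {n : ℕ} (σ : Perm (Fin n)) : length σ = (invSet σ).card := by
  apply le_antisymm
  · generalize hk : (invSet σ).card = k
    induction k generalizing σ with
    | zero =>
      rw [eq_one_of_lt_succ (σ := σ), length_one]
      intro a b h
      have hab : a < b := by rw [Fin.lt_def]; omega
      have h1 := Finset.card_eq_zero.mp hk
      have h2 : (a, b) ∉ invSet σ := by simp [h1]
      rw [mem_invSet] at h2
      push Not at h2
      exact lt_of_le_of_ne (h2 hab) fun h3 => hab.ne (σ.injective h3)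
    | succ k ih =>
      by_cases h : ∃ a b : Fin n, (a : ℕ) + 1 = b ∧ σ.symm b < σ.symm a
      · obtain ⟨a, b, h, hd⟩ := h
        have h1 := card_invSet_of_descent h hd
        have h2 := ih (swap a b * σ) (by omega)
        have h3 := length_simple_mul_le (mem_idx h) (simple n b * σ)
        rw [simple_mul_cancel, simple_eq_swap h] at h3
        omega
      · push Not at h
        have h1 : σ.symm = 1 := eq_one_of_lt_succ fun a b hab =>
          lt_of_le_of_ne (h a b hab) fun h3 => by
            have := congrArg Fin.val (σ.symm.injective h3)
            omega
        have h2 : σ = 1 := by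
          rw [← symm_symm σ, h1]; rfl
        rw [h2, length_one]
        omega
  · obtain ⟨w, h1, rfl, h3⟩ := exists_word_length σ
    rw [← h3]
    clear h3
    induction w with
    | nil =>
      simp only [List.map_nil, List.prod_nil, List.length_nil, nonpos_iff_eq_zero,
        Finset.card_eq_zero]
      ext ⟨p, q⟩
      rw [mem_invSet]
      simp only [Perm.one_apply, Finset.notMem_empty, iff_false, not_and, not_lt]
      exact le_of_lt
    | cons i w ih =>
      obtain ⟨a, b, h, rfl⟩ := mem_idx_iff.mp (h1 i (by simp))
      have h2 := ih fun j hj => h1 j (by simp [hj])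
      rw [List.map_cons, List.prod_cons, simple_eq_swap h, List.length_cons]
      generalize (w.map (simple n)).prod = σ at *
      rcases lt_trichotomy (σ.symm a) (σ.symm b) with h3 | h3 | h3
      · rw [card_invSet_swap_mul h h3]; omega
      · have := congrArg Fin.val (σ.symm.injective h3)
        omega
      · have := card_invSet_of_descent h h3
        omega

/-! ### Descents and weak orders in terms of inversions -/

theorem mem_desL {n : ℕ} {a b : Fin n} (h : (a : ℕ) + 1 = b) {σ : Perm (Fin n)} :
    (b : ℕ) ∈ desL σ ↔ σ.symm b < σ.symm a := by
  change _ ∧ _ ↔ _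
  rw [simple_eq_swap h, length_eq_card, length_eq_card]
  rcases lt_trichotomy (σ.symm a) (σ.symm b) with h3 | h3 | h3
  · rw [card_invSet_swap_mul h h3]
    simp [h3.not_gt]
  · have := congrArg Fin.val (σ.symm.injective h3)
    omega
  · rw [card_invSet_of_descent h h3]
    simp [h3, mem_idx h]

theorem notMem_desL {n : ℕ} {a b : Fin n} (h : (a : ℕ) + 1 = b) {σ : Perm (Fin n)} :
    (b : ℕ) ∉ desL σ ↔ σ.symm a < σ.symm b := by
  rw [mem_desL h, not_lt]
  refine ⟨fun h1 => lt_of_le_of_ne h1 fun h3 => ?_, le_of_lt⟩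
  have := congrArg Fin.val (σ.symm.injective h3)
  omega

/-- For the converse, induct on the number of missing inversions. If `τ * σ⁻¹` is increasing, it is
the identity. Otherwise it reverses two adjacent values; their positions are not an inversion of
`σ`, since `τ` would inherit it with the opposite order, so one cover upwards from `σ` stays inside
the inversions of `τ`. -/
theorem weakL_iff_subset {n : ℕ} {σ τ : Perm (Fin n)} :
    weakL σ τ ↔ invSet σ ⊆ invSet τ := by
  constructor
  · intro h
    induction h with
    | refl => exact subset_rfl
    | tail _ h ih =>
      obtain ⟨i, hi, hd, rfl⟩ := h
      obtain ⟨a, b, h, rfl⟩ := mem_idx_iff.mp hi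
      rw [simple_eq_swap h, invSet_swap_mul h ((notMem_desL h).mp hd)]
      exact ih.trans (Finset.subset_insert _ _)
  · intro h
    generalize hk : (invSet τ).card - (invSet σ).card = k
    induction k generalizing σ with
    | zero =>
      have h1 : invSet σ = invSet τ := Finset.eq_of_subset_of_card_le h (by omega)
      have key : τ * σ⁻¹ = 1 := eq_one_of_lt_succ fun a b hab => by
        have hlt : a < b := by rw [Fin.lt_def]; omega
        change τ (σ.symm a) < τ (σ.symm b)
        rcases lt_trichotomy (σ.symm a) (σ.symm b) with h3 | h3 | h3
        · have h4 : (σ.symm a, σ.symm b) ∉ invSet τ := by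
            rw [← h1, mem_invSet]; simp [hlt.le]
          rw [mem_invSet] at h4
          push Not at h4
          exact lt_of_le_of_ne (h4 h3) fun h5 => h3.ne (τ.injective h5)
        · exact absurd (σ.symm.injective h3) hlt.ne
        · have h4 : (σ.symm b, σ.symm a) ∈ invSet σ := by
            rw [mem_invSet]; simpa using ⟨h3, hlt⟩
          rw [h1, mem_invSet] at h4
          exact h4.2
      rw [mul_inv_eq_one] at key
      rw [key]
      exact Relation.ReflTransGen.refl
    | succ k ih =>
      by_cases hex : ∃ a b : Fin n, (a : ℕ) + 1 = b ∧ τ (σ.symm b) < τ (σ.symm a)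
      · obtain ⟨a, b, hab, hlt⟩ := hex
        have hlt' : a < b := by rw [Fin.lt_def]; omega
        have h3 : σ.symm a < σ.symm b := by
          rcases lt_trichotomy (σ.symm a) (σ.symm b) with h3 | h3 | h3
          · exact h3
          · exact absurd (σ.symm.injective h3) hlt'.ne
          · have h4 : (σ.symm b, σ.symm a) ∈ invSet σ := by
              rw [mem_invSet]; simpa using ⟨h3, hlt'⟩
            exact absurd (mem_invSet.mp (h h4)).2 hlt.not_gt
        have h5 : invSet (swap a b * σ) ⊆ invSet τ := by
          rw [invSet_swap_mul hab h3, Finset.insert_subset_iff]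
          exact ⟨mem_invSet.mpr ⟨h3, hlt⟩, h⟩
        have h6 := card_invSet_swap_mul hab h3
        refine Relation.ReflTransGen.head ⟨b, mem_idx hab, (notMem_desL hab).mpr h3, rfl⟩ ?_
        rw [simple_eq_swap hab]
        exact ih h5 (by omega)
      · push Not at hex
        have key : τ * σ⁻¹ = 1 := eq_one_of_lt_succ fun a b hab => by
          refine lt_of_le_of_ne (hex a b hab) fun h5 => ?_
          have := congrArg Fin.val (σ.symm.injective (τ.injective h5))
          omega
        rw [mul_inv_eq_one] at key
        rw [key]
        exact Relation.ReflTransGen.refl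

/-- The left weak order in terms of relative orders of letters. -/
theorem weakL_iff {n : ℕ} {σ τ : Perm (Fin n)} :
    weakL σ τ ↔ ∀ p q, p < q → σ q < σ p → τ q < τ p := by
  rw [weakL_iff_subset]
  constructor
  · intro h p q hpq hlt
    exact (mem_invSet.mp (h (mem_invSet.mpr ⟨hpq, hlt⟩))).2
  · rintro h ⟨p, q⟩ hpq
    rw [mem_invSet] at hpq ⊢
    exact ⟨hpq.1, h p q hpq.1 hpq.2⟩

theorem length_inv {n : ℕ} (σ : Perm (Fin n)) : length σ⁻¹ = length σ := by
  have h : ∀ σ : Perm (Fin n), length σ⁻¹ ≤ length σ := by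
    intro σ
    obtain ⟨w, h1, rfl, h3⟩ := exists_word_length σ
    rw [← h3]
    refine Nat.sInf_le ⟨w.reverse, by simpa using h1, ?_, by simp⟩
    rw [List.prod_inv_reverse, List.map_map, List.map_reverse]
    congr 2
    refine List.map_congr_left fun i _ => ?_
    exact (simple_inv n i).symm
  exact le_antisymm (h σ) (by simpa using h σ⁻¹)

theorem desR_eq {n : ℕ} (σ : Perm (Fin n)) : desR σ = desL σ⁻¹ := by
  ext i
  change _ ∧ _ ↔ _ ∧ _
  rw [← length_inv (σ * simple n i), mul_inv_rev, simple_inv, length_inv σ]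

theorem coverR_iff {n : ℕ} {σ τ : Perm (Fin n)} : coverR σ τ ↔ coverL σ⁻¹ τ⁻¹ := by
  unfold coverR coverL
  refine exists_congr fun i => and_congr_right fun _ => ?_
  rw [desR_eq, inv_eq_iff_eq_inv, mul_inv_rev, simple_inv, inv_inv]

theorem weakR_iff {n : ℕ} {σ τ : Perm (Fin n)} : weakR σ τ ↔ weakL σ⁻¹ τ⁻¹ := by
  constructor
  · intro h
    induction h with
    | refl => exact Relation.ReflTransGen.refl
    | tail _ h ih => exact ih.tail (coverR_iff.mp h)
  · intro h
    have : ∀ a b : Perm (Fin n), weakL a b → weakR a⁻¹ b⁻¹ := by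
      intro a b h
      induction h with
      | refl => exact Relation.ReflTransGen.refl
      | tail _ h ih => exact ih.tail (coverR_iff.mpr (by simpa using h))
    simpa using this _ _ h

theorem coverL.length_eq {n : ℕ} {σ τ : Perm (Fin n)} (h : coverL σ τ) :
    length τ = length σ + 1 := by
  have h1 := h.length_lt
  obtain ⟨i, hi, hd, rfl⟩ := h
  have := length_simple_mul_le hi σ
  omega

/-- Length is strictly monotone in the left weak order, so a greatest element is the unique longest
one. This removes the choice in `longestIn`. -/
theorem longestIn_eq {n : ℕ} {A : Set (Perm (Fin n))} (hA : A.Nonempty) {m : Perm (Fin n)}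
    (hm : m ∈ A) (h : ∀ z ∈ A, weakL z m) : longestIn A hA = m := by
  obtain ⟨h1, h2⟩ := (Set.exists_max_image A length A.toFinite hA).choose_spec
  rcases (h _ h1).eq_or_length_lt with h3 | h3
  exacts [h3, absurd (h2 m hm) h3.not_ge]

/-! ### Rigidity of descent-preserving isomorphisms -/

/-- If `j` is a neighbour of `i`, the two non-descents put the positions of three consecutive values
in increasing order, and exchanging two neighbours among them leaves the other pair in order. Thus
the generator of a cover can be recovered from the descent sets at its two ends. -/
theorem eq_of_mem_desL_simple_mul {n i j : ℕ} {σ : Perm (Fin n)} (hi : i ∈ idx n)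
    (hiσ : i ∉ desL σ) (hjσ : j ∉ desL σ) (h : j ∈ desL (simple n i * σ)) : j = i := by
  obtain ⟨a, b, hab, rfl⟩ := mem_idx_iff.mp hi
  obtain ⟨c, d, hcd, rfl⟩ := mem_idx_iff.mp h.1
  rw [notMem_desL hab] at hiσ
  rw [notMem_desL hcd] at hjσ
  rw [mem_desL hcd, simple_eq_swap hab] at h
  change σ.symm ((swap a b).symm d) < σ.symm ((swap a b).symm c) at h
  rw [symm_swap, swap_apply_def, swap_apply_def] at h
  by_contra hne
  have h1 : d ≠ b := fun h => hne (congrArg Fin.val h)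
  have h2 : c ≠ a := fun h => hne (by have := congrArg Fin.val h; omega)
  have h3 : d = a → c ≠ b := fun h4 h5 => by subst h4 h5; omega
  split_ifs at h with h4 h5 h5
  · exact h3 h4 h5
  · subst h4
    exact absurd (h.trans hjσ) hiσ.not_gt
  · subst h5
    exact absurd (h.trans hiσ) hjσ.not_gt
  · exact absurd h hjσ.not_gt

theorem mem_intervalL_left {n : ℕ} {σ ρ : Perm (Fin n)} (h : weakL σ ρ) : σ ∈ intervalL σ ρ :=
  ⟨Relation.ReflTransGen.refl, h⟩

theorem intervalL_left_inj {n : ℕ} {σ ρ σ' ρ' : Perm (Fin n)} (h : weakL σ ρ) (h' : weakL σ' ρ')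
    (he : intervalL σ ρ = intervalL σ' ρ') : σ = σ' :=
  weakL_antisymm (he ▸ mem_intervalL_left h' : σ' ∈ intervalL σ ρ).1
    (he ▸ mem_intervalL_left h : σ ∈ intervalL σ' ρ').1

theorem intervalLE_iff {n : ℕ} {σ ρ σ' ρ' : Perm (Fin n)} (h : weakL σ ρ) (h' : weakL σ' ρ') :
    intervalLE (intervalL σ ρ) (intervalL σ' ρ') ↔ weakR σ σ' := by
  constructor
  · rintro ⟨a, b, c, d, h1, h2, h3, h4, h5⟩
    rwa [intervalL_left_inj h h1 h3, intervalL_left_inj h' h2 h4]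
  · intro h5
    exact ⟨σ, ρ, σ', ρ', h, h', rfl, rfl, h5⟩

/-- Walk up a saturated chain from the bottom, which goes to the bottom. Covers go to covers, and
preservation of descents makes each cover use the same generator as its image, so both ends are
multiplied on the left by the same element. -/
theorem descentIso_apply {n : ℕ} {σ ρ σ' ρ' : Perm (Fin n)} (h' : weakL σ' ρ')
    (f : intervalL σ ρ ≃ intervalL σ' ρ')
    (hf : ∀ γ γ', weakL γ.1 γ'.1 ↔ weakL (f γ).1 (f γ').1) (hd : ∀ γ, desL γ.1 = desL (f γ).1)
    (γ : intervalL σ ρ) : (f γ).1 = γ.1 * σ⁻¹ * σ' := by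
  have key : ∀ γ, weakL σ γ → ∀ hγ : γ ∈ intervalL σ ρ, (f ⟨γ, hγ⟩).1 = γ * σ⁻¹ * σ' := by
    intro γ hγ
    induction hγ with
    | refl =>
      intro hγ
      rw [mul_inv_cancel, one_mul]
      obtain ⟨g, hg⟩ := f.surjective ⟨σ', mem_intervalL_left h'⟩
      have h1 : weakL (f ⟨σ, hγ⟩).1 (f g).1 := (hf _ _).mp g.2.1
      rw [hg] at h1
      exact weakL_antisymm h1 (f ⟨σ, hγ⟩).2.1
    | @tail δ ε hδ hc ih =>
      intro hε
      have hδ' : δ ∈ intervalL σ ρ := ⟨hδ, (Relation.ReflTransGen.single hc).trans hε.2⟩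
      have h1 : weakL (f ⟨δ, hδ'⟩).1 (f ⟨ε, hε⟩).1 :=
        (hf _ _).mp (Relation.ReflTransGen.single hc)
      have h2 := hc.length_eq
      -- The first cover `θ` on a chain between the images pulls back to an element above `δ` and
      -- weakly below `ε`. Since `ε` is only one longer than `δ`, that element is `ε`, so the image
      -- of the cover is a cover.
      rcases Relation.ReflTransGen.cases_head h1 with h3 | ⟨θ, h3, h4⟩
      · have := f.injective (Subtype.ext h3)
        simp only [Subtype.mk.injEq] at this
        subst this
        omega
      · have hθ : θ ∈ intervalL σ' ρ' :=
          ⟨(f ⟨δ, hδ'⟩).2.1.tail h3, h4.trans (f ⟨ε, hε⟩).2.2⟩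
        obtain ⟨⟨g, hg⟩, hgθ⟩ := f.surjective ⟨θ, hθ⟩
        have h5 : weakL δ g := (hf ⟨δ, hδ'⟩ ⟨g, hg⟩).mpr (by
          rw [hgθ]; exact Relation.ReflTransGen.single h3)
        have h6 : weakL g ε := (hf ⟨g, hg⟩ ⟨ε, hε⟩).mpr (by rw [hgθ]; exact h4)
        have h7 : g ≠ δ := by
          rintro rfl
          rw [hgθ] at h3
          exact lt_irrefl _ h3.length_lt
        have h8 : g = ε := by
          rcases h5.eq_or_length_lt with h8 | h8
          · exact absurd h8.symm h7
          rcases h6.eq_or_length_lt with h9 | h9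
          · exact h9
          · omega
        subst h8
        have h9 : coverL (f ⟨δ, hδ'⟩).1 (f ⟨g, hε⟩).1 := by rw [hgθ]; exact h3
        obtain ⟨i, hi, hin, rfl⟩ := hc
        obtain ⟨j, hj, hjn, hje⟩ := h9
        rw [← hd] at hjn
        have h10 : j ∈ desL (f ⟨simple n i * δ, hε⟩).1 := by
          rw [hje]
          obtain ⟨a, b, hab, rfl⟩ := mem_idx_iff.mp hj
          rw [hd, notMem_desL hab] at hjn
          rw [mem_desL hab, simple_eq_swap hab]
          change (f ⟨δ, hδ'⟩).1.symm ((swap a b).symm b) < (f ⟨δ, hδ'⟩).1.symm ((swap a b).symm a)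
          simpa using hjn
        rw [← hd] at h10
        obtain rfl := eq_of_mem_desL_simple_mul hi hin hjn h10
        rw [hje, ih hδ']
        group
  exact key γ.1 γ.2.1 γ.2

/-! ### Words of pairs of fillings -/

section Words

variable {n : ℕ} {B : Type*}

/-- Here `ω` numbers the boxes as positions while `S` and `S'` supply the letters, so pairs of
positions can be replaced by pairs of boxes. -/
theorem weakL_word_iff {ω S S' : B ≃ Fin n} :
    weakL (ω.symm.trans S) (ω.symm.trans S') ↔
      ∀ b c, ω b < ω c → S c < S b → S' c < S' b := by
  rw [weakL_iff]
  constructor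
  · intro h b c
    simpa using h (ω b) (ω c)
  · intro h p q
    simpa using h (ω.symm p) (ω.symm q)

theorem mem_desL_word_iff {ω S : B ≃ Fin n} {b c : B} (h : (S b : ℕ) + 1 = S c) :
    (S c : ℕ) ∈ desL (ω.symm.trans S) ↔ ω c < ω b := by
  rw [mem_desL h]
  simp

/-- Inverting a word exchanges the roles of positions and letters. -/
theorem weakR_word_iff {S ω ω' : B ≃ Fin n} :
    weakR (ω.symm.trans S) (ω'.symm.trans S) ↔
      ∀ b c, S b < S c → ω c < ω b → ω' c < ω' b := by
  rw [weakR_iff]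
  exact weakL_word_iff (ω := S) (S := ω) (S' := ω')

end Words

/-! ### The tree order on the boxes of a composition diagram -/

/-- The tree order on boxes: the two leftmost columns form a chain, row by row from bottom to top,
to which the remaining boxes of each row are attached. -/
def treeLE (b c : ℕ × ℕ) : Prop := (b.2 = c.2 ∧ b.1 ≤ c.1) ∨ (b.2 < c.2 ∧ b.1 ≤ 2)

/-- The pairs of boxes of a composition diagram whose images in `𝒢` are in weakly
north-west position. -/
def labelLE (b c : ℕ × ℕ) : Prop :=
  (b.2 = c.2 ∧ b.1 ≤ c.1) ∨
    (c.2 < b.2 ∧ (3 ≤ c.1 ∨ (c.1 = 2 ∧ b.1 = 1 ∧ b.2 = c.2 + 1)))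

/-- Two boxes are incomparable only if the lower one lies in column at least 3, and then `labelLE`
puts the higher one first. This is why a labeling has no freedom on incomparable pairs. -/
theorem treeLE_trichotomy (b c : ℕ × ℕ) :
    treeLE b c ∨ treeLE c b ∨ (b.2 < c.2 ∧ 3 ≤ b.1) ∨ (c.2 < b.2 ∧ 3 ≤ c.1) := by
  unfold treeLE; omega

theorem treeLE.antisymm {b c : ℕ × ℕ} (h : treeLE b c) (h' : treeLE c b) : b = c := by
  unfold treeLE at *
  ext <;> omega

theorem treeLE.trans {b c d : ℕ × ℕ} (h : treeLE b c) (h' : treeLE c d) : treeLE b d := by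
  unfold treeLE at *
  omega

/-! ### Comparison of the reading orders -/

section Keys

variable {K : Type*} [LinearOrder K] (key : ℕ × ℕ → K) (hkey : Function.Injective key)
  {n : ℕ} {D : Diagram} (hD : D.card = n)

theorem fillBy_lt_iff (b c : {b // b ∈ D}) :
    fillBy key hkey hD b < fillBy key hkey hD c ↔ key b.1 < key c.1 :=
  enum_symm_lt_iff key hkey hD b c

end Keys

theorem keySink_lt {b c : ℕ × ℕ} : keySink b < keySink c ↔
    (b.1 ≤ 2 ∧ c.1 ≤ 2 ∧ (b.2 < c.2 ∨ b.2 = c.2 ∧ b.1 < c.1)) ∨ (b.1 ≤ 2 ∧ 3 ≤ c.1) ∨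
      (3 ≤ b.1 ∧ 3 ≤ c.1 ∧ (c.2 < b.2 ∨ b.2 = c.2 ∧ b.1 < c.1)) := by
  unfold keySink
  split_ifs <;> simp [Prod.Lex.toLex_lt_toLex] <;> omega

theorem keySource_lt {b c : ℕ × ℕ} : keySource b < keySource c ↔
    b.2 < c.2 ∨ b.2 = c.2 ∧ b.1 < c.1 := by
  simp [keySource, Prod.Lex.toLex_lt_toLex]

theorem keyLRTB_lt {b c : ℕ × ℕ} : keyLRTB b < keyLRTB c ↔
    c.2 < b.2 ∨ b.2 = c.2 ∧ b.1 < c.1 := by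
  simp [keyLRTB, Prod.Lex.toLex_lt_toLex]

theorem keyTBLR_lt {b c : ℕ × ℕ} : keyTBLR b < keyTBLR c ↔
    b.1 < c.1 ∨ b.1 = c.1 ∧ c.2 < b.2 := by
  simp [keyTBLR, Prod.Lex.toLex_lt_toLex]

theorem keyDr_lt {l : ℕ} {b c : ℕ × ℕ} : keyDr l b < keyDr l c ↔
    ((b.1 = 1 ∨ b.1 = 2 ∧ b.2 < l) ∧ (c.1 = 1 ∨ c.1 = 2 ∧ c.2 < l) ∧
      (b.1 + b.2 < c.1 + c.2 ∨ b.1 + b.2 = c.1 + c.2 ∧ b.1 < c.1)) ∨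
    ((b.1 = 1 ∨ b.1 = 2 ∧ b.2 < l) ∧ ¬(c.1 = 1 ∨ c.1 = 2 ∧ c.2 < l)) ∨
    (¬(b.1 = 1 ∨ b.1 = 2 ∧ b.2 < l) ∧ ¬(c.1 = 1 ∨ c.1 = 2 ∧ c.2 < l) ∧
      (c.2 < b.2 ∨ b.2 = c.2 ∧ b.1 < c.1)) := by
  unfold keyDr
  split_ifs <;> simp [Prod.Lex.toLex_lt_toLex] <;> omega

variable {n : ℕ}

/-- The sink filling. -/
def sinkF (α : Composition n) : Filling n (cd α) := fillBy keySink keySink_injective (card_cd α)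

/-- The source filling. -/
def sourceF (α : Composition n) : Filling n (cd α) :=
  fillBy keySource keySource_injective (card_cd α)

/-- The boxes numbered by rows from top to bottom, from left to right. -/
def rowF (α : Composition n) : Filling n (cd α) := fillBy keyLRTB keyLRTB_injective (card_cd α)

/-- The boxes numbered in diagonal reading order. -/
def diagF (α : Composition n) : Filling n (cd α) :=
  fillBy (keyDr α.length) (keyDr_injective α.length) (card_cd α)

variable {α : Composition n}

theorem sinkF_lt {b c : {b // b ∈ cd α}} : sinkF α b < sinkF α c ↔
    (b.1.1 ≤ 2 ∧ c.1.1 ≤ 2 ∧ (b.1.2 < c.1.2 ∨ b.1.2 = c.1.2 ∧ b.1.1 < c.1.1)) ∨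
      (b.1.1 ≤ 2 ∧ 3 ≤ c.1.1) ∨
      (3 ≤ b.1.1 ∧ 3 ≤ c.1.1 ∧ (c.1.2 < b.1.2 ∨ b.1.2 = c.1.2 ∧ b.1.1 < c.1.1)) :=
  (fillBy_lt_iff _ _ _ _ _).trans keySink_lt

theorem sourceF_lt {b c : {b // b ∈ cd α}} : sourceF α b < sourceF α c ↔
    b.1.2 < c.1.2 ∨ b.1.2 = c.1.2 ∧ b.1.1 < c.1.1 :=
  (fillBy_lt_iff _ _ _ _ _).trans keySource_lt

theorem rowF_lt {b c : {b // b ∈ cd α}} : rowF α b < rowF α c ↔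
    c.1.2 < b.1.2 ∨ b.1.2 = c.1.2 ∧ b.1.1 < c.1.1 :=
  (fillBy_lt_iff _ _ _ _ _).trans keyLRTB_lt

theorem sinkF_le_of_treeLE {b c : {b // b ∈ cd α}} (h : treeLE b.1 c.1) :
    sinkF α b ≤ sinkF α c := by
  rw [← not_lt, sinkF_lt]
  unfold treeLE at h
  omega

theorem sourceF_le_of_treeLE {b c : {b // b ∈ cd α}} (h : treeLE b.1 c.1) :
    sourceF α b ≤ sourceF α c := by
  rw [← not_lt, sourceF_lt]
  unfold treeLE at h
  omega

/-! ### Labelings and their linear extensions -/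

/-- The labelings of the boxes that are increasing with respect to `labelLE`. -/
def IsLabeling (ω : Filling n (cd α)) : Prop := ∀ b c, labelLE b.1 c.1 → ω b ≤ ω c

/-- The linear extensions of the tree order, as permutations of the labels. -/
def linExt (ω : Filling n (cd α)) : Set (Perm (Fin n)) :=
  {γ | ∀ b c : {b // b ∈ cd α}, treeLE b.1 c.1 → γ (ω b) ≤ γ (ω c)}

theorem word_mem_linExt {ω S : Filling n (cd α)} :
    ω.symm.trans S ∈ linExt ω ↔
      ∀ b c : {b // b ∈ cd α}, treeLE b.1 c.1 → S b ≤ S c := by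
  simp [linExt]

theorem exists_eq_word (ω : Filling n (cd α)) (γ : Perm (Fin n)) :
    ∃ S : Filling n (cd α), γ = ω.symm.trans S :=
  ⟨ω.trans γ, by ext; simp⟩

theorem lt_of_le_of_box_ne {S : Filling n (cd α)} {b c : {b // b ∈ cd α}} (h : S b ≤ S c)
    (hne : b ≠ c) : S b < S c := lt_of_le_of_ne h fun h => hne (S.injective h)

/-- Sink and source both extend the tree order. On an incomparable pair the labels and the sink put
the higher box first, and the source puts it last, so any linear extension lies between them.
Conversely, on a comparable pair sink and source agree, which forces everything in between to agree
with them. -/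
theorem linExt_eq_intervalL {ω : Filling n (cd α)} (hω : IsLabeling ω) :
    linExt ω = intervalL (ω.symm.trans (sinkF α)) (ω.symm.trans (sourceF α)) := by
  ext γ
  obtain ⟨S, rfl⟩ := exists_eq_word ω γ
  rw [word_mem_linExt]
  change _ ↔ weakL _ _ ∧ weakL _ _
  rw [weakL_word_iff, weakL_word_iff]
  constructor
  · intro hS
    constructor
    · intro b c h1 h2
      have hne : c ≠ b := by rintro rfl; exact lt_irrefl _ h1
      rcases treeLE_trichotomy b.1 c.1 with h | h | h | h
      · exact absurd h2 (sinkF_le_of_treeLE h).not_gt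
      · exact lt_of_le_of_box_ne (hS _ _ h) hne
      · exact absurd h1 (hω c b (by unfold labelLE; omega)).not_gt
      · rw [sinkF_lt] at h2
        omega
    · intro b c h1 h2
      have hne : c ≠ b := by rintro rfl; exact lt_irrefl _ h1
      rcases treeLE_trichotomy b.1 c.1 with h | h | h | h
      · exact absurd h2 (hS _ _ h).not_gt
      · exact lt_of_le_of_box_ne (sourceF_le_of_treeLE h) hne
      · exact absurd h1 (hω c b (by unfold labelLE; omega)).not_gt
      · rw [sourceF_lt]
        omega
  · rintro ⟨h1, h2⟩ b c h
    rcases eq_or_ne b c with rfl | hne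
    · exact le_rfl
    by_contra! hlt
    rcases lt_trichotomy (ω b) (ω c) with h3 | h3 | h3
    · exact (sourceF_le_of_treeLE h).not_gt (h2 b c h3 hlt)
    · exact hne (ω.injective h3)
    · have h4 := lt_of_le_of_box_ne (sinkF_le_of_treeLE h) hne
      exact (h1 c b h3 h4).not_gt hlt

theorem weakL_sink_source {ω : Filling n (cd α)} (hω : IsLabeling ω) :
    weakL (ω.symm.trans (sinkF α)) (ω.symm.trans (sourceF α)) := by
  have h : ω.symm.trans (sinkF α) ∈ linExt ω :=
    word_mem_linExt.mpr fun b c => sinkF_le_of_treeLE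
  rw [linExt_eq_intervalL hω] at h
  exact h.2

theorem linExt_mem_Intervals {ω : Filling n (cd α)} (hω : IsLabeling ω) :
    linExt ω ∈ Intervals n := ⟨_, _, weakL_sink_source hω, linExt_eq_intervalL hω⟩

theorem part_pos {y : ℕ} (hy : 1 ≤ y) (hy' : y ≤ α.length) : 0 < part α y := by
  rw [part, List.getD_eq_getElem _ _ (show y - 1 < α.blocks.length by
    rw [Composition.blocks_length]; omega)]
  exact α.blocks_pos' _ _

theorem one_mem_cd {y : ℕ} (hy : 1 ≤ y) (hy' : y ≤ α.length) : (1, y) ∈ cd α :=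
  (mem_cd _ _).mpr ⟨⟨hy, hy'⟩, le_rfl, part_pos hy hy'⟩

/-- Two boxes that can be consecutive in a linear extension of the tree order. -/
theorem labelLE_or_of_consecutive (hα : IsPeak α) {b c : {b // b ∈ cd α}}
    (h : ¬treeLE c.1 b.1)
    (hb : ∀ d : {b // b ∈ cd α}, treeLE b.1 d.1 → treeLE d.1 c.1 → d = b ∨ d = c) :
    labelLE b.1 c.1 ∨ labelLE c.1 b.1 := by
  obtain ⟨⟨x, y⟩, hxy⟩ := b
  obtain ⟨⟨x', y'⟩, hxy'⟩ := c
  have h1 := (mem_cd α _).mp hxy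
  have h2 := (mem_cd α _).mp hxy'
  simp only [treeLE, labelLE, Subtype.forall, Prod.forall, Subtype.mk.injEq, Prod.mk.injEq]
    at h h1 h2 hb ⊢
  by_cases hlt : y < y' ∧ x ≤ 2
  · by_cases hx : x = 1
    -- The peak condition enters here: the second box of row `y` exists and separates the first box
    -- from all higher rows. From the second box, in the other case, the only cover into another row
    -- ends at the first box of the next row.
    · have h3 := hb 2 y (hα.two_mem h1.1.1 (one_mem_cd (y := y + 1) (by omega) (by omega)))
      omega
    · have h3 := hb 1 (y + 1) (one_mem_cd (y := y + 1) (by omega) (by omega))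
      omega
  · omega

/-- Relabel the positions and keep the filling. Two linear extensions can differ only on
incomparable pairs, and a descent compares the labels of boxes with consecutive entries. All
labelings agree on both kinds of pairs. -/
theorem DEquiv_linExt (hα : IsPeak α) {ω ω' : Filling n (cd α)} (hω : IsLabeling ω)
    (hω' : IsLabeling ω') : DEquiv (linExt ω) (linExt ω') := by
  refine ⟨(Equiv.mulRight (ω'.symm.trans ω : Perm (Fin n))).subtypeEquiv fun γ => ?_, ?_, ?_⟩
  · simp [linExt]
  · rintro ⟨γ, hγ⟩ ⟨γ', hγ'⟩
    obtain ⟨S, rfl⟩ := exists_eq_word ω γ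
    obtain ⟨S', rfl⟩ := exists_eq_word ω γ'
    rw [word_mem_linExt] at hγ hγ'
    have key : ∀ T : Filling n (cd α), (ω.symm.trans T : Perm (Fin n)) * (ω'.symm.trans ω) =
        ω'.symm.trans T := by
      intro T
      ext
      simp
    simp only [Equiv.subtypeEquiv_apply, Equiv.coe_mulRight, key]
    rw [weakL_word_iff, weakL_word_iff]
    have main : ∀ ω₁ ω₂ : Filling n (cd α), IsLabeling ω₁ → IsLabeling ω₂ →
        (∀ b c, ω₁ b < ω₁ c → S c < S b → S' c < S' b) →
        (∀ b c, ω₂ b < ω₂ c → S c < S b → S' c < S' b) := by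
      intro ω₁ ω₂ h₁ h₂ h b c h3 h4
      have hne : c ≠ b := by rintro rfl; exact lt_irrefl _ h3
      rcases treeLE_trichotomy b.1 c.1 with h5 | h5 | h5 | h5
      · exact absurd h4 (hγ _ _ h5).not_gt
      · exact lt_of_le_of_box_ne (hγ' _ _ h5) hne
      · exact absurd h3 (h₂ c b (by unfold labelLE; omega)).not_gt
      · exact h b c (lt_of_le_of_box_ne (h₁ b c (by unfold labelLE; omega)) hne.symm) h4
    exact ⟨main ω ω' hω hω', main ω' ω hω' hω⟩
  · rintro ⟨γ, hγ⟩
    obtain ⟨S, rfl⟩ := exists_eq_word ω γ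
    rw [word_mem_linExt] at hγ
    have key : (ω.symm.trans S : Perm (Fin n)) * (ω'.symm.trans ω) = ω'.symm.trans S := by
      ext
      simp
    simp only [Equiv.subtypeEquiv_apply, Equiv.coe_mulRight, key]
    ext i
    by_cases hi : i ∈ idx n
    · obtain ⟨a, b, hab, rfl⟩ := mem_idx_iff.mp hi
      obtain ⟨a, rfl⟩ := S.surjective a
      obtain ⟨b, rfl⟩ := S.surjective b
      rw [mem_desL_word_iff hab, mem_desL_word_iff hab]
      have hlt : S a < S b := by rw [Fin.lt_def]; omega
      have hne : a ≠ b := by rintro rfl; exact lt_irrefl _ hlt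
      rcases labelLE_or_of_consecutive hα (b := a) (c := b) (fun h => (hγ _ _ h).not_gt hlt)
        (fun d h1 h2 => by
          have h3 := hγ _ _ h1
          have h4 := hγ _ _ h2
          rw [Fin.le_def] at h3 h4
          rcases (show (S d : ℕ) = S a ∨ (S d : ℕ) = S b by omega) with h5 | h5
          · exact Or.inl (S.injective (Fin.ext h5))
          · exact Or.inr (S.injective (Fin.ext h5))) with h | h
      · simp [(hω _ _ h).not_gt, (hω' _ _ h).not_gt]
      · simp [lt_of_le_of_box_ne (hω _ _ h) hne.symm, lt_of_le_of_box_ne (hω' _ _ h) hne.symm]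
    · exact iff_of_false (fun h => hi h.1) (fun h => hi h.1)

/-- Two boxes that do not have a box in between are consecutive in a linear extension. -/
theorem exists_linear_extension_consecutive {b c : {b // b ∈ cd α}}
    (h : ¬treeLE c.1 b.1)
    (hb : ∀ d : {b // b ∈ cd α}, treeLE b.1 d.1 → treeLE d.1 c.1 → d = b ∨ d = c) :
    ∃ S : Filling n (cd α), (∀ d e : {b // b ∈ cd α}, treeLE d.1 e.1 → S d ≤ S e) ∧
      (S b : ℕ) + 1 = S c := by
  classical
  have hbc : b.1 ≠ c.1 := fun he => h (by rw [he]; unfold treeLE; omega)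
  -- Sort in four stages: all other boxes below `b` or `c`, then `b`, then `c`, then the rest.
  -- Nothing lies between `b` and `c`, so stage 0 contains nothing above either of them; ties within
  -- a stage are broken by the source order.
  let st : ℕ × ℕ → ℕ := fun d => if d = b.1 then 1 else if d = c.1 then 2 else
    if treeLE d b.1 ∨ treeLE d c.1 then 0 else 3
  let key : ℕ × ℕ → ℕ ×ₗ (ℕ ×ₗ ℕ) := fun d => toLex (st d, keySource d)
  have hkey : Function.Injective key := by
    intro d e he
    apply keySource_injective
    simpa [key] using (Prod.mk.inj (toLex.injective he)).2
  have hlt : ∀ d e, key d < key e ↔ st d < st e ∨ st d = st e ∧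
      (d.2 < e.2 ∨ d.2 = e.2 ∧ d.1 < e.1) := by
    intro d e
    simp only [key, Prod.Lex.toLex_lt_toLex, keySource_lt]
  have hstb : st b.1 = 1 := by simp [st]
  have hstc : st c.1 = 2 := by simp [st, hbc.symm]
  have hst1 : ∀ d, st d = 1 → d = b.1 := by
    intro d hd
    by_contra h1
    simp only [st, if_neg h1] at hd
    split_ifs at hd <;> omega
  have hst2 : ∀ d, st d = 2 → d = c.1 := by
    intro d hd
    by_contra h1
    simp only [st, if_neg h1] at hd
    split_ifs at hd <;> omega
  have hst0 : ∀ d, d ≠ b.1 → d ≠ c.1 → treeLE d b.1 ∨ treeLE d c.1 → st d = 0 := by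
    intro d h1 h2 h3
    simp only [st, if_neg h1, if_neg h2, if_pos h3]
  have hst3 : ∀ d, d ≠ b.1 → d ≠ c.1 → ¬(treeLE d b.1 ∨ treeLE d c.1) → st d = 3 := by
    intro d h1 h2 h3
    simp only [st, if_neg h1, if_neg h2, if_neg h3]
  have hst_le : ∀ d, st d ≤ 3 := by
    intro d
    simp only [st]
    split_ifs <;> omega
  have hmono : ∀ d e : {b // b ∈ cd α}, treeLE d.1 e.1 → st d.1 ≤ st e.1 := by
    intro d e hde
    by_cases heb : e.1 = b.1
    · rw [heb, hstb]
      rw [heb] at hde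
      by_cases hdb : d.1 = b.1
      · rw [hdb, hstb]
      · rw [hst0 d.1 hdb (fun hdc => h (hdc ▸ hde)) (Or.inl hde)]
        omega
    by_cases hec : e.1 = c.1
    · rw [hec, hstc]
      rw [hec] at hde
      by_cases hdb : d.1 = b.1
      · rw [hdb, hstb]; omega
      by_cases hdc : d.1 = c.1
      · rw [hdc, hstc]
      · rw [hst0 d.1 hdb hdc (Or.inr hde)]
        omega
    by_cases he : treeLE e.1 b.1 ∨ treeLE e.1 c.1
    · rw [hst0 d.1 ?_ ?_ (he.imp hde.trans hde.trans)]
      · omega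
      · intro hdb
        rw [hdb] at hde
        rcases he with he | he
        · exact heb (he.antisymm hde)
        · rcases hb e hde he with rfl | rfl
          exacts [heb rfl, hec rfl]
      · intro hdc
        rw [hdc] at hde
        rcases he with he | he
        · exact h (hde.trans he)
        · exact hec (he.antisymm hde)
    · rw [hst3 e.1 heb hec he]
      exact hst_le _
  refine ⟨fillBy key hkey (card_cd α), ?_, ?_⟩
  · intro d e hde
    rw [← not_lt, fillBy_lt_iff, hlt]
    have h1 := hmono d e hde
    unfold treeLE at hde
    omega
  · set S := fillBy key hkey (card_cd α) with hS
    have h1 : S b < S c := by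
      rw [hS, fillBy_lt_iff, hlt, hstb, hstc]
      omega
    by_contra hne
    have h2 : (S b : ℕ) + 1 < S c := by rw [Fin.lt_def] at h1; omega
    obtain ⟨d, hd⟩ := S.surjective ⟨(S b : ℕ) + 1, h2.trans (S c).2⟩
    have h3 : S b < S d := by rw [Fin.lt_def, hd]; simp
    have h4 : S d < S c := by rw [Fin.lt_def, hd]; exact h2
    rw [hS, fillBy_lt_iff, hlt, hstb] at h3
    rw [hS, fillBy_lt_iff, hlt, hstc] at h4
    have h5 := hst1 d.1
    have h6 := hst2 d.1
    rcases (show st d.1 = 1 ∨ st d.1 = 2 by omega) with h7 | h7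
    · rw [h5 h7, hstb] at h3
      omega
    · rw [h6 h7, hstc] at h4
      omega

theorem isLabeling_rowF : IsLabeling (rowF α) := by
  intro b c h
  rw [← not_lt, rowF_lt]
  unfold labelLE at h
  omega

theorem isLabeling_diagF : IsLabeling (diagF α) := by
  intro b c h
  rw [← not_lt]
  refine fun hlt => ?_
  replace hlt := keyDr_lt.mp ((fillBy_lt_iff _ _ _ _ _).mp hlt)
  have h1 := (mem_cd _ _).mp b.2
  have h2 := (mem_cd _ _).mp c.2
  unfold labelLE at h
  omega

/-- A word that agrees with the row numbering on all pairs of boxes which can be consecutive is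
a labeling. -/
theorem isLabeling_of_consecutive {ω : Filling n (cd α)}
    (h : ∀ b c : {b // b ∈ cd α}, ¬treeLE c.1 b.1 →
      (∀ d : {b // b ∈ cd α}, treeLE b.1 d.1 → treeLE d.1 c.1 → d = b ∨ d = c) →
      (rowF α c < rowF α b ↔ ω c < ω b)) : IsLabeling ω := by
  -- Only neighbours in a row are covers of the tree order, so the relation along the row is
  -- obtained by chaining them.
  have hrow : ∀ k x y (h1 : (x, y) ∈ cd α) (h2 : (x + k, y) ∈ cd α),
      ω ⟨(x, y), h1⟩ ≤ ω ⟨(x + k, y), h2⟩ := by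
    intro k x y h1
    induction k with
    | zero => exact fun _ => le_rfl
    | succ k ih =>
      intro h2
      have h3 : (x + k, y) ∈ cd α := by
        rw [mem_cd] at *
        simp only at *
        omega
      refine (ih h3).trans ?_
      rw [← not_lt, ← h, rowF_lt]
      · simp only
        omega
      · simp only [treeLE]
        omega
      · rintro ⟨⟨x', y'⟩, hd⟩
        simp only [treeLE, Subtype.mk.injEq, Prod.mk.injEq]
        omega
  rintro ⟨⟨x, y⟩, hb⟩ ⟨⟨x', y'⟩, hc⟩ hbc
  by_cases h1 : y = y'
  · subst h1
    obtain ⟨k, rfl⟩ := Nat.exists_eq_add_of_le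
      (show x ≤ x' by simp only [labelLE] at hbc; omega)
    exact hrow k x y hb hc
  by_cases h2 : 3 ≤ x'
  · rw [← not_lt, ← h, rowF_lt]
    · simp only [labelLE] at hbc ⊢
      omega
    · simp only [labelLE, treeLE] at hbc ⊢
      omega
    · rintro ⟨⟨x'', y''⟩, hd⟩
      simp only [labelLE, treeLE, Subtype.mk.injEq, Prod.mk.injEq] at hbc ⊢
      omega
  -- What remains is `b` $=(1,y'+1)$ and `c` $=(2,y')$. The tree order has `c` below `b`, so the
  -- hypothesis is applied with the two boxes exchanged.
  · refine le_of_lt ?_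
    have h3 := (mem_cd _ _).mp hb
    have h4 := (mem_cd _ _).mp hc
    rw [← h, rowF_lt]
    · simp only [labelLE] at hbc ⊢
      omega
    · simp only [labelLE, treeLE] at hbc ⊢
      omega
    · rintro ⟨⟨x'', y''⟩, hd⟩
      have h5 := (mem_cd _ _).mp hd
      simp only [labelLE, treeLE, Subtype.mk.injEq, Prod.mk.injEq] at hbc h3 h4 h5 ⊢
      omega

/-- By rigidity the isomorphism only changes the numbering of positions, from `rowF` to some `ω`.
Equality of descents, tested on an extension where two boxes have consecutive entries, compares the
two numberings on that pair. -/
theorem exists_labeling_of_DEquiv {J : Set (Perm (Fin n))} (hJ : J ∈ Intervals n)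
    (h : DEquiv (linExt (rowF α)) J) : ∃ ω : Filling n (cd α), IsLabeling ω ∧ J = linExt ω := by
  obtain ⟨σ', ρ', h', rfl⟩ := hJ
  have hI := linExt_eq_intervalL (isLabeling_rowF (α := α))
  rw [hI] at h
  obtain ⟨f, hf, hd⟩ := h
  -- The numbering for which the sink word is the bottom `σ'` of the given interval.
  let ω : Filling n (cd α) := (sinkF α).trans σ'.symm
  have hfS : ∀ S : Filling n (cd α), ∀ hS : (rowF α).symm.trans S ∈ intervalL _ _,
      (f ⟨(rowF α).symm.trans S, hS⟩).1 = ω.symm.trans S := by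
    intro S hS
    rw [descentIso_apply h' f hf hd]
    ext x
    change ((S ((rowF α).symm (((rowF α).symm.trans (sinkF α)).symm (σ' x))) : Fin n) : ℕ) = _
    simp [ω]
  have hmem : ∀ S : Filling n (cd α), (rowF α).symm.trans S ∈ intervalL _ _ ↔ _ :=
    fun S => (iff_of_eq (congrArg ((rowF α).symm.trans S ∈ ·) hI)).symm.trans word_mem_linExt
  refine ⟨ω, isLabeling_of_consecutive fun b c h1 h2 => ?_, ?_⟩
  · obtain ⟨S, hS, hbc⟩ := exists_linear_extension_consecutive h1 h2
    have h3 := hd ⟨_, (hmem S).mpr hS⟩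
    rw [hfS] at h3
    rw [← mem_desL_word_iff hbc, ← mem_desL_word_iff hbc]
    exact iff_of_eq (congrArg ((S c : ℕ) ∈ ·) h3)
  · ext γ
    obtain ⟨S, rfl⟩ := exists_eq_word ω γ
    rw [word_mem_linExt, ← hmem]
    constructor
    · intro hγ
      obtain ⟨⟨g, hg⟩, hgγ⟩ := f.surjective ⟨_, hγ⟩
      obtain ⟨S', rfl⟩ := exists_eq_word (rowF α) g
      have h3 := hfS S' hg
      rw [hgγ] at h3
      have h4 : S = S' := by
        ext b
        have := congrArg (fun e : Perm (Fin n) => (e (ω b) : ℕ)) h3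
        simpa using this
      rwa [h4]
    · intro hS
      rw [← hfS S hS]
      exact (f ⟨_, hS⟩).2

/-! ### Ranks of boxes -/

theorem fillBy_val {K : Type*} [LinearOrder K] (key : ℕ × ℕ → K)
    (hkey : Function.Injective key) {D : Diagram} (hD : D.card = n) (b : {b // b ∈ D}) :
    (fillBy key hkey hD b : ℕ) = (D.filter fun c => key c < key b.1).card := by
  rw [← Fin.card_Iio, ← Finset.card_map
    ((fillBy key hkey hD).symm.toEmbedding.trans (Function.Embedding.subtype _))]
  congr 1
  ext c
  simp only [Finset.mem_map, Finset.mem_Iio, Finset.mem_filter]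
  constructor
  · rintro ⟨v, hv, rfl⟩
    refine ⟨((fillBy key hkey hD).symm v).2, ?_⟩
    change key ((fillBy key hkey hD).symm v).1 < _
    rw [← fillBy_lt_iff key hkey hD]
    simpa using hv
  · rintro ⟨hc, hlt⟩
    exact ⟨fillBy key hkey hD ⟨c, hc⟩, (fillBy_lt_iff key hkey hD _ _).mpr hlt, by simp⟩

theorem val_add_one_eq {B : Type*} (F : B ≃ Fin n) {b c : B} (h : F b < F c)
    (hd : ∀ d, F b < F d → ¬F d < F c) : (F b : ℕ) + 1 = F c := by
  by_contra hne
  have h2 : (F b : ℕ) + 1 < F c := by rw [Fin.lt_def] at h; omega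
  refine hd (F.symm ⟨(F b : ℕ) + 1, h2.trans (F c).2⟩) ?_ ?_
  · rw [apply_symm_apply, Fin.lt_def]
    simp
  · rw [apply_symm_apply, Fin.lt_def]
    exact h2

/-- The 0-based position of the first box of a row counts the boxes in higher rows. As a descent
index it marks the step into that row, which ties row breaks to $\mathrm{set}(\alpha^{\mathrm r})$.
-/
theorem rowF_first {y : ℕ} (h : (1, y) ∈ cd α) :
    (rowF α ⟨(1, y), h⟩ : ℕ) = ∑ r ∈ Finset.Ioc y α.length, part α r := by
  rw [rowF, fillBy_val]
  have h1 : ((cd α).filter fun c => keyLRTB c < keyLRTB (1, y)) =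
      (Finset.Ioc y α.length).biUnion
        fun r => (Finset.Icc 1 (part α r)).image fun x => (x, r) := by
    ext ⟨x, r⟩
    simp only [Finset.mem_filter, mem_cd, keyLRTB_lt, Finset.mem_biUnion, Finset.mem_image,
      Finset.mem_Icc, Finset.mem_Ioc, Prod.mk.injEq]
    constructor
    · rintro ⟨h1, h2⟩
      exact ⟨r, by omega, x, by omega, rfl, rfl⟩
    · rintro ⟨r, h1, x, h2, rfl, rfl⟩
      omega
  rw [h1, Finset.card_biUnion]
  · refine Finset.sum_congr rfl fun r _ => ?_
    rw [Finset.card_image_of_injective _ (fun x y h => (Prod.mk.inj h).1)]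
    simp
  · intro i _ j _ hij
    rw [Function.onFun, Finset.disjoint_left]
    intro b hb hb'
    simp only [Finset.mem_image] at hb hb'
    obtain ⟨x, -, rfl⟩ := hb
    obtain ⟨y, -, h⟩ := hb'
    exact hij (Prod.mk.inj h).2.symm

/-! ### The permutation $w_1(\mathrm{set}(\alpha^{\mathrm r}))$ -/

theorem part_reverse {i : ℕ} (h : 1 ≤ i) (h' : i ≤ α.length) :
    part α.reverse i = part α (α.length + 1 - i) := by
  have h1 := α.blocks_length
  rw [part, part, List.getD_eq_getElem _ _ (by
    change _ < α.blocks.reverse.length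
    rw [List.length_reverse]; omega), List.getD_eq_getElem _ _ (by omega)]
  change α.blocks.reverse[i - 1]'_ = _
  rw [List.getElem_reverse]
  congr 1
  omega

theorem mem_compSet_reverse {i : ℕ} : i ∈ compSet α.reverse ↔
    ∃ y, 1 ≤ y ∧ y < α.length ∧ i = ∑ r ∈ Finset.Ioc y α.length, part α r := by
  have hl : α.reverse.length = α.length := by
    change α.blocks.reverse.length = α.blocks.length
    simp
  have hs : ∀ j ≤ α.length, ∑ i ∈ Finset.Icc 1 j, part α.reverse i =
      ∑ r ∈ Finset.Ioc (α.length - j) α.length, part α r := by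
    intro j hj
    refine Finset.sum_nbij' (fun i => α.length + 1 - i) (fun i => α.length + 1 - i)
      ?_ ?_ ?_ ?_ ?_
    · intro i hi
      simp only [Finset.mem_Icc, Finset.mem_Ioc] at *
      omega
    · intro i hi
      simp only [Finset.mem_Icc, Finset.mem_Ioc] at *
      omega
    · intro i hi
      simp only [Finset.mem_Icc] at *
      omega
    · intro i hi
      simp only [Finset.mem_Ioc] at *
      omega
    · intro i hi
      simp only [Finset.mem_Icc] at hi
      exact part_reverse hi.1 (by omega)
  constructor
  · rintro ⟨j, h1, h2, rfl⟩
    rw [hl] at h2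
    exact ⟨α.length - j, by omega, by omega, hs j h2.le⟩
  · rintro ⟨y, h1, h2, rfl⟩
    refine ⟨α.length - y, by omega, by omega, ?_⟩
    rw [hs _ (by omega), Nat.sub_sub_self h2.le]

theorem mem_desR {a b : Fin n} (h : (a : ℕ) + 1 = b) {σ : Perm (Fin n)} :
    (b : ℕ) ∈ desR σ ↔ σ b < σ a := by
  rw [desR_eq, mem_desL h]
  rfl

/-- Allowing descents only at row breaks means increasing along each row. The source word read by
rows from the top also inverts every pair in different rows, so it is the greatest such permutation
in the left weak order. -/
theorem w1_compSet_reverse :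
    w1 n (compSet α.reverse) = (rowF α).symm.trans (sourceF α) := by
  refine longestIn_eq _ ?_ ?_
  · intro i hi
    refine ⟨hi.1, fun h => h.2 ?_⟩
    obtain ⟨a, b, hab, rfl⟩ := mem_idx_iff.mp hi.1
    rw [mem_desR hab] at hi
    obtain ⟨b, rfl⟩ := (rowF α).surjective b
    obtain ⟨a, rfl⟩ := (rowF α).surjective a
    have h1 : rowF α a < rowF α b := by rw [Fin.lt_def]; omega
    simp only [trans_apply, symm_apply_apply] at hi
    rw [rowF_lt] at h1
    rw [sourceF_lt] at hi
    have ha := (mem_cd _ _).mp a.2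
    obtain ⟨⟨x, y⟩, hb⟩ := b
    have hb' := (mem_cd _ _).mp hb
    simp only at h1 hi hb'
    -- Otherwise the first box of row `y` would be numbered strictly between the consecutive
    -- positions of `a` and `b`.
    have hx : x = 1 := by
      by_contra hx
      have h3 : rowF α a < rowF α ⟨(1, y), one_mem_cd hb'.1.1 hb'.1.2⟩ := by
        rw [rowF_lt]; exact Or.inl (by simp only; omega)
      have h4 : rowF α ⟨(1, y), one_mem_cd hb'.1.1 hb'.1.2⟩ < rowF α ⟨(x, y), hb⟩ := by
        rw [rowF_lt]; exact Or.inr ⟨rfl, by simp only; omega⟩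
      rw [Fin.lt_def] at h3 h4
      omega
    subst hx
    exact mem_compSet_reverse.mpr ⟨y, hb'.1.1, by omega, rowF_first hb⟩
  · intro z hz
    have hstep : ∀ x y (h1 : (x, y) ∈ cd α) (h2 : (x + 1, y) ∈ cd α),
        z (rowF α ⟨(x, y), h1⟩) < z (rowF α ⟨(x + 1, y), h2⟩) := by
      intro x y h1 h2
      have h3 : (rowF α ⟨(x, y), h1⟩ : ℕ) + 1 = rowF α ⟨(x + 1, y), h2⟩ := by
        refine val_add_one_eq _ ?_ fun d => ?_
        · rw [rowF_lt]; simp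
        · rw [rowF_lt, rowF_lt]; simp only; omega
      by_contra hlt
      have hne : z (rowF α ⟨(x, y), h1⟩) ≠ z (rowF α ⟨(x + 1, y), h2⟩) := by
        intro h4
        have := congrArg Fin.val (z.injective h4)
        omega
      have h4 := (mem_desR h3).mpr (lt_of_le_of_ne (not_lt.mp hlt) hne.symm)
      have h5 := hz h4
      have h6 : ((rowF α ⟨(x + 1, y), h2⟩ : Fin n) : ℕ) ∈ compSet α.reverse := by
        by_contra h6
        exact h5.2 ⟨h5.1, h6⟩
      obtain ⟨y', h7, h8, h9⟩ := mem_compSet_reverse.mp h6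
      rw [← rowF_first (one_mem_cd h7 h8.le)] at h9
      have h10 := (rowF α).injective (Fin.ext h9)
      simp only [Subtype.mk.injEq, Prod.mk.injEq] at h10
      have := ((mem_cd _ _).mp h1).2.1
      simp only at this
      omega
    have hrow : ∀ k x y (h1 : (x, y) ∈ cd α) (h2 : (x + k, y) ∈ cd α),
        z (rowF α ⟨(x, y), h1⟩) ≤ z (rowF α ⟨(x + k, y), h2⟩) := by
      intro k x y h1
      induction k with
      | zero => exact fun _ => le_rfl
      | succ k ih =>
        intro h2
        have h3 : (x + k, y) ∈ cd α := by
          rw [mem_cd] at *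
          simp only at *
          omega
        exact (ih h3).trans (hstep _ _ h3 h2).le
    rw [weakL_iff]
    intro p q hpq hlt
    obtain ⟨⟨⟨x, y⟩, hb⟩, rfl⟩ := (rowF α).surjective p
    obtain ⟨⟨⟨x', y'⟩, hc⟩, rfl⟩ := (rowF α).surjective q
    simp only [trans_apply, symm_apply_apply]
    rw [rowF_lt] at hpq
    rw [sourceF_lt]
    simp only at hpq ⊢
    refine Or.inl (hpq.resolve_right ?_)
    rintro ⟨rfl, hx⟩
    obtain ⟨k, rfl⟩ := Nat.exists_eq_add_of_le hx.le
    exact (hrow k x y hb hc).not_gt hlt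

theorem sinkInterval_eq (hα : IsPeak α) : sinkInterval α hα = linExt (rowF α) := by
  rw [linExt_eq_intervalL isLabeling_rowF, sinkInterval, w1_compSet_reverse]
  rfl

/-! ### The smallest interval -/

theorem diagF_lt {b c : {b // b ∈ cd α}} :
    diagF α b < diagF α c ↔ keyDr α.length b.1 < keyDr α.length c.1 := fillBy_lt_iff _ _ _ _ _

theorem keyDr_lt_of {l : ℕ} {b c : ℕ × ℕ} (hc : c.1 = 1 ∨ c.1 = 2 ∧ c.2 < l) :
    keyDr l b < keyDr l c ↔ (b.1 = 1 ∨ b.1 = 2 ∧ b.2 < l) ∧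
      (b.1 + b.2 < c.1 + c.2 ∨ b.1 + b.2 = c.1 + c.2 ∧ b.1 < c.1) := by
  rw [keyDr_lt]
  omega

/-- The diagonal reading of the sink is $1,3,2,5,4,\dots$ on its diagonal part and increasing
afterwards. -/
theorem diagF_inversion {b c : {b // b ∈ cd α}} (h : diagF α b < diagF α c)
    (h' : sinkF α c < sinkF α b) :
    b.1.1 = 1 ∧ c.1.1 = 2 ∧ b.1.2 = c.1.2 + 1 ∧ b.1.2 ≤ α.length := by
  rw [diagF_lt, keyDr_lt] at h
  rw [sinkF_lt] at h'
  have h1 := (mem_cd _ _).mp b.2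
  have h2 := (mem_cd _ _).mp c.2
  omega

theorem diagF_one (hα : IsPeak α) {j : ℕ} (hj : 1 ≤ j) (h : (1, j + 1) ∈ cd α) :
    (diagF α ⟨(1, j + 1), h⟩ : ℕ) + 1 = 2 * j := by
  have hl := ((mem_cd _ _).mp h).1.2
  simp only at hl
  rw [diagF, fillBy_val]
  have h1 : ((cd α).filter fun c => keyDr α.length c < keyDr α.length (1, j + 1)) =
      (Finset.Icc 1 j).image (fun y => (1, y)) ∪ (Finset.Ico 1 j).image (fun y => (2, y)) := by
    ext ⟨x, y⟩
    rw [Finset.mem_filter, keyDr_lt_of (Or.inl rfl)]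
    simp only [Finset.mem_union, Finset.mem_image,
      Finset.mem_Icc, Finset.mem_Ico, Prod.mk.injEq]
    constructor
    · rintro ⟨h1, h2⟩
      have h3 := (mem_cd _ _).mp h1
      simp only at h3
      by_cases hx : x = 1
      · exact Or.inl ⟨y, by omega, by omega, rfl⟩
      · exact Or.inr ⟨y, by omega, by omega, rfl⟩
    · rintro (⟨y, h1, rfl, rfl⟩ | ⟨y, h1, rfl, rfl⟩)
      · exact ⟨one_mem_cd h1.1 (by omega), by omega⟩
      · exact ⟨hα.two_mem h1.1 (one_mem_cd (by omega) (by omega)), by omega⟩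
  rw [h1, Finset.card_union_of_disjoint, Finset.card_image_of_injective,
    Finset.card_image_of_injective]
  · simp
    omega
  · exact fun x y h => (Prod.mk.inj h).2
  · exact fun x y h => (Prod.mk.inj h).2
  · rw [Finset.disjoint_left]
    intro b hb hb'
    obtain ⟨x, -, rfl⟩ := Finset.mem_image.mp hb
    obtain ⟨y, -, h⟩ := Finset.mem_image.mp hb'
    simp at h

theorem diagF_two (hα : IsPeak α) {j : ℕ} (hj : 1 ≤ j) (h : (1, j + 1) ∈ cd α)
    (h' : (2, j) ∈ cd α) : (diagF α ⟨(2, j), h'⟩ : ℕ) = 2 * j := by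
  have hl := ((mem_cd _ _).mp h).1.2
  simp only at hl
  rw [← diagF_one hα hj h]
  refine (val_add_one_eq _ ?_ fun d => ?_).symm
  · rw [diagF_lt, keyDr_lt_of (Or.inr ⟨rfl, hl⟩)]
    exact ⟨Or.inl rfl, Or.inr ⟨by simp only; omega, by simp⟩⟩
  · intro h1 h2
    rw [diagF_lt, keyDr_lt_of (Or.inr ⟨rfl, hl⟩)] at h2
    rw [diagF_lt, keyDr_lt_of h2.1] at h1
    have h3 := (mem_cd _ _).mp d.2
    simp only at h1 h2 h3
    omega

/-- The generators $s_{2j}$ act on the disjoint blocks $\{2j,2j+1\}$; with 0-based values, the block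
of $p$ is recorded by $\lfloor (p+1)/2\rfloor$. Positions beyond the last block are fixed. -/
theorem parabolic_evens {l : ℕ} {z : Perm (Fin n)} (hz : z ∈ parabolic n (evens (l - 1))) :
    ∀ p : Fin n, ((z p : ℕ) + 1) / 2 = ((p : ℕ) + 1) / 2 ∧
      (2 * l ≤ (p : ℕ) + 1 → (z p : ℕ) = p) := by
  induction hz using Subgroup.closure_induction with
  | mem x hx =>
    obtain ⟨i, ⟨j, h1, h2, rfl⟩, rfl⟩ := hx
    intro p
    unfold simple
    split_ifs
    · rw [swap_apply_def]
      simp only [Fin.ext_iff]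
      split_ifs
      · simp only; omega
      · simp only; omega
      · exact ⟨rfl, fun _ => rfl⟩
    · simp
  | one => simp
  | mul x y _ _ hx hy =>
    intro p
    have h1 := hx (y p)
    have h2 := hy p
    rw [Perm.mul_apply]
    omega
  | inv x _ hx =>
    intro p
    have h1 := hx (x⁻¹ p)
    rw [show x (x⁻¹ p) = p from x.apply_symm_apply p] at h1
    omega

/-- Every $s_{2j}$ is a left descent of the longest element, which would otherwise have a longer
neighbour in the subgroup. As blocks are preserved, it swaps each block, and these swaps are exactly
the inversions of the diagonal reading of the sink. -/
theorem w0_evens (hα : IsPeak α) :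
    w0 n (evens (α.length - 1)) = (diagF α).symm.trans (sinkF α) := by
  have hspec := (Set.exists_max_image (parabolic n (evens (α.length - 1)) : Set (Perm (Fin n)))
    length (Set.toFinite _) ⟨1, one_mem _⟩).choose_spec
  change w0 n (evens (α.length - 1)) ∈ _ ∧ (∀ b ∈ _, length b ≤ length (w0 n _)) at hspec
  obtain ⟨hm, hmax⟩ := hspec
  have hm' := (parabolic n (evens (α.length - 1))).inv_mem hm
  set m := w0 n (evens (α.length - 1))
  have hswap : ∀ a b : Fin n, (a : ℕ) + 1 = b → (∃ j, 1 ≤ j ∧ j < α.length ∧ (b : ℕ) = 2 * j) →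
      m b < m a := by
    rintro a b hab ⟨j, h1, h2, h3⟩
    have h4 : m.symm b < m.symm a := by
      by_contra h5
      rw [← mem_desL hab] at h5
      have h6 : coverL m (simple n b * m) := ⟨b, mem_idx hab, h5, rfl⟩
      refine h6.length_lt.not_ge (hmax _ (Subgroup.mul_mem _ (Subgroup.subset_closure ?_) hm))
      exact ⟨b, ⟨j, h1, by omega, h3⟩, rfl⟩
    have h5 := parabolic_evens hm' a
    have h6 := parabolic_evens hm' b
    change ((m.symm a : ℕ) + 1) / 2 = _ ∧ _ at h5
    change ((m.symm b : ℕ) + 1) / 2 = _ ∧ _ at h6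
    rw [Fin.lt_def] at h4
    have h7 : m.symm a = b := Fin.ext (by omega)
    have h8 : m.symm b = a := Fin.ext (by omega)
    rw [symm_apply_eq] at h7 h8
    rw [← h7, ← h8, Fin.lt_def]
    omega
  apply weakL_antisymm
  · rw [weakL_iff]
    intro p q hpq hlt
    have h1 := parabolic_evens hm p
    have h2 := parabolic_evens hm q
    rw [Fin.lt_def] at hpq hlt
    have hj : 1 ≤ ((q : ℕ)) / 2 := by omega
    have hl : (q : ℕ) / 2 + 1 ≤ α.length := by omega
    have hb := one_mem_cd (α := α) (y := (q : ℕ) / 2 + 1) (by omega) hl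
    have hc := hα.two_mem hj hb
    have hp : p = diagF α ⟨_, hb⟩ := Fin.ext (by
      have := diagF_one hα hj hb
      omega)
    have hq : q = diagF α ⟨_, hc⟩ := Fin.ext (by
      have := diagF_two hα hj hb hc
      omega)
    simp only [trans_apply]
    rw [(symm_apply_eq _).mpr hp, (symm_apply_eq _).mpr hq, sinkF_lt]
    simp
  · rw [weakL_iff]
    intro p q hpq hlt
    obtain ⟨⟨⟨x, y⟩, hb⟩, rfl⟩ := (diagF α).surjective p
    obtain ⟨⟨⟨x', y'⟩, hc⟩, rfl⟩ := (diagF α).surjective q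
    simp only [trans_apply, symm_apply_apply] at hlt
    obtain ⟨rfl, rfl, rfl, h1⟩ := diagF_inversion hpq hlt
    simp only at hb hc h1
    have h2 := ((mem_cd _ _).mp hc).1.1
    have h3 : (diagF α ⟨(1, y' + 1), hb⟩ : ℕ) + 1 = 2 * y' := diagF_one hα h2 hb
    have h4 := diagF_two hα h2 hb hc
    exact hswap (diagF α ⟨(1, y' + 1), hb⟩) (diagF α ⟨(2, y'), hc⟩) (h3.trans h4.symm) ⟨y', h2, by omega, h4⟩

theorem sourceInterval_eq (hα : IsPeak α) : sourceInterval α hα = linExt (diagF α) := by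
  rw [linExt_eq_intervalL isLabeling_diagF, sourceInterval, w0_evens hα]
  rfl

/-! ### The equivalence class -/

theorem eqClass_sinkInterval (hα : IsPeak α) :
    eqClass (sinkInterval α hα) = {J | ∃ ω : Filling n (cd α), IsLabeling ω ∧ J = linExt ω} := by
  rw [sinkInterval_eq]
  ext J
  constructor
  · rintro ⟨h1, h2⟩
    exact exists_labeling_of_DEquiv h1 h2
  · rintro ⟨ω, hω, rfl⟩
    exact ⟨linExt_mem_Intervals hω, DEquiv_linExt hα isLabeling_rowF hω⟩

/-- Both bottoms are sink words, so the order on intervals compares the label inversions relative to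
the sink order. -/
theorem intervalLE_linExt {ω ω' : Filling n (cd α)} (hω : IsLabeling ω) (hω' : IsLabeling ω') :
    intervalLE (linExt ω) (linExt ω') ↔
      ∀ b c, sinkF α b < sinkF α c → ω c < ω b → ω' c < ω' b := by
  rw [linExt_eq_intervalL hω, linExt_eq_intervalL hω',
    intervalLE_iff (weakL_sink_source hω) (weakL_sink_source hω'), weakR_word_iff]

/-- The diagonal numbering inverts the sink order only on the pairs $(1,y+1)$, $(2,y)$, and there
every labeling must do so. -/
theorem isMinOf_sourceInterval (hα : IsPeak α) :
    IsMinOf (sourceInterval α hα) (eqClass (sinkInterval α hα)) := by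
  rw [eqClass_sinkInterval, sourceInterval_eq]
  refine ⟨⟨_, isLabeling_diagF, rfl⟩, ?_⟩
  rintro _ ⟨ω, hω, rfl⟩
  rw [intervalLE_linExt isLabeling_diagF hω]
  intro b c h1 h2
  obtain ⟨h3, h4, h5, h6⟩ := diagF_inversion h2 h1
  refine lt_of_le_of_box_ne (hω c b (by unfold labelLE; omega)) ?_
  rintro rfl
  omega

/-- If the sink order and the row numbering both put `b` before `c`, then `labelLE` relates `b` to
`c`, so no labeling can invert that pair. -/
theorem isMaxOf_sinkInterval (hα : IsPeak α) :
    IsMaxOf (sinkInterval α hα) (eqClass (sinkInterval α hα)) := by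
  rw [eqClass_sinkInterval, sinkInterval_eq]
  refine ⟨⟨_, isLabeling_rowF, rfl⟩, ?_⟩
  rintro _ ⟨ω, hω, rfl⟩
  rw [intervalLE_linExt hω isLabeling_rowF]
  intro b c h1 h2
  by_contra h3
  refine h2.not_ge (hω b c ?_)
  have hne : b.1.2 = c.1.2 → b.1.1 ≠ c.1.1 := fun h h' => h1.ne (by
    rw [Subtype.ext (Prod.ext h' h)])
  rw [rowF_lt] at h3
  rw [sinkF_lt] at h1
  unfold labelLE
  omega

/-! ### The diagram `𝒢` -/

theorem kShift_length : kShift α α.length = (α.length : ℤ) - 1 := by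
  simp [kShift]

theorem kShift_succ {y : ℕ} (h : y < α.length) :
    kShift α y = kShift α (y + 1) + part α (y + 1) - 2 := by
  unfold kShift
  rw [← Finset.insert_Ioc_add_one_left_eq_Ioc h, Finset.sum_insert (by simp)]
  ring

theorem two_le_part (hα : IsPeak α) {y : ℕ} (hy : 1 ≤ y) (h : y < α.length) : 2 ≤ part α y := by
  have h1 := hα y hy h
  have h2 := part_pos hy h.le
  omega

/-- In $\mathscr G$, the boxes of a row from the third on start to the right of all these boxes in
higher rows. For adjacent rows the shift is chosen to make them abut; for the rest, each
intermediate part is at least 2. -/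
theorem kShift_add_part_lt (hα : IsPeak α) {y y' : ℕ} (h : y < y') (h' : y' ≤ α.length) :
    kShift α y' + part α y' < kShift α y + 3 := by
  induction y', h using Nat.le_induction with
  | base =>
    have := kShift_succ (α := α) (y := y) (by omega)
    rw [Nat.succ_eq_add_one]
    omega
  | succ k hk ih =>
    have h1 := ih (by omega)
    have h2 := kShift_succ (α := α) (y := k) (by omega)
    have h3 := two_le_part hα (y := k) (by omega) (by omega)
    omega

/-- The bound is $\ell-2$ rather than $\ell-1$ because the last part may be 1. It still puts third
boxes beyond column $\ell$ and makes the truncation in `gCol` harmless. -/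
theorem length_le_kShift (hα : IsPeak α) {y : ℕ} (hy' : y ≤ α.length)
    (hl : 1 ≤ α.length) : (α.length : ℤ) - 2 ≤ kShift α y := by
  rcases hy'.eq_or_lt with rfl | h
  · rw [kShift_length]; omega
  · have h1 := kShift_add_part_lt hα h le_rfl
    have h2 := part_pos (α := α) hl le_rfl
    rw [kShift_length] at h1
    omega

/-- The column in `𝒢` of a box of the composition diagram. -/
def gCol (α : Composition n) (b : ℕ × ℕ) : ℕ :=
  if b.1 ≤ 2 then b.2 + b.1 - 1 else (kShift α b.2 + b.1).toNat

theorem gCol_of_le {b : ℕ × ℕ} (h : b.1 ≤ 2) : gCol α b = b.2 + b.1 - 1 := by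
  rw [gCol, if_pos h]

theorem gCol_of_three_le (hα : IsPeak α) {b : ℕ × ℕ} (hb : b ∈ cd α) (h : 3 ≤ b.1) :
    (gCol α b : ℤ) = kShift α b.2 + b.1 := by
  have h1 := (mem_cd _ _).mp hb
  have h2 := length_le_kShift hα h1.1.2 (by omega)
  rw [gCol, if_neg (by omega)]
  omega

theorem length_lt_gCol (hα : IsPeak α) {b : ℕ × ℕ} (hb : b ∈ cd α) (h : 3 ≤ b.1) :
    α.length < gCol α b := by
  have h1 := (mem_cd _ _).mp hb
  have h2 := length_le_kShift hα h1.1.2 (by omega)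
  have h3 := gCol_of_three_le hα hb h
  omega

theorem add_two_le_gCol (hα : IsPeak α) {b : ℕ × ℕ} (hb : b ∈ cd α) (h : 3 ≤ b.1) :
    b.2 + 2 ≤ gCol α b := by
  have h1 := (mem_cd _ _).mp hb
  rcases h1.1.2.eq_or_lt with h2 | h2
  · have h3 := gCol_of_three_le hα hb h
    rw [h2, kShift_length] at h3
    omega
  · have h3 := length_lt_gCol hα hb h
    omega

theorem gCol_row (hα : IsPeak α) {b c : ℕ × ℕ} (hb : b ∈ cd α) (hc : c ∈ cd α)
    (h : b.2 = c.2) (h1 : 3 ≤ b.1) (h2 : 3 ≤ c.1) : gCol α b + c.1 = gCol α c + b.1 := by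
  have h3 := gCol_of_three_le hα hb h1
  have h4 := gCol_of_three_le hα hc h2
  rw [h] at h3
  omega

theorem gCol_lt (hα : IsPeak α) {b c : ℕ × ℕ} (hb : b ∈ cd α) (hc : c ∈ cd α)
    (h : b.2 < c.2) (h1 : 3 ≤ b.1) : gCol α c < gCol α b := by
  have hc' := (mem_cd _ _).mp hc
  have h3 := gCol_of_three_le hα hb h1
  by_cases h2 : 3 ≤ c.1
  · have h4 := gCol_of_three_le hα hc h2
    have h5 := kShift_add_part_lt hα h hc'.1.2
    omega
  · have h4 := gCol_of_le (α := α) (b := c) (by omega)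
    rcases hc'.1.2.eq_or_lt with h5 | h5
    · have h6 := kShift_add_part_lt hα h hc'.1.2
      have h7 := kShift_length (α := α)
      rw [h5] at h6 hc'
      omega
    · have h6 := length_lt_gCol hα hb h1
      omega

/-- The first two boxes of the rows form a rising staircase, the chain of the tree. The other boxes
lie to the right of the staircase boxes in their own and higher rows, and lower rows reach further
right, so they are comparable only as the tree prescribes. -/
theorem treeLE_iff (hα : IsPeak α) {b c : ℕ × ℕ} (hb : b ∈ cd α) (hc : c ∈ cd α) :
    treeLE b c ↔ gCol α b ≤ gCol α c ∧ b.2 ≤ c.2 := by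
  have hb' := (mem_cd _ _).mp hb
  have hc' := (mem_cd _ _).mp hc
  have h1 := gCol_of_le (α := α) (b := b)
  have h2 := gCol_of_le (α := α) (b := c)
  have h3 := length_lt_gCol hα hb
  have h4 := length_lt_gCol hα hc
  have h3' := add_two_le_gCol hα hb
  have h4' := add_two_le_gCol hα hc
  have h5 := gCol_row hα hb hc
  have h6 := gCol_lt hα hb hc
  unfold treeLE
  omega

/-- The exceptional pair $(1,y+1)$, $(2,y)$ arises because both boxes land in column $y+1$ of the
staircase. -/
theorem labelLE_iff (hα : IsPeak α) {b c : ℕ × ℕ} (hb : b ∈ cd α) (hc : c ∈ cd α) :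
    labelLE b c ↔ gCol α b ≤ gCol α c ∧ c.2 ≤ b.2 := by
  have hb' := (mem_cd _ _).mp hb
  have hc' := (mem_cd _ _).mp hc
  have h1 := gCol_of_le (α := α) (b := b)
  have h2 := gCol_of_le (α := α) (b := c)
  have h3 := length_lt_gCol hα hb
  have h4 := length_lt_gCol hα hc
  have h3' := add_two_le_gCol hα hb
  have h4' := add_two_le_gCol hα hc
  have h5 := gCol_row hα hb hc
  have h6 := gCol_lt hα hc hb
  unfold labelLE
  omega

/-- The sink order reads the columns of $\mathscr G$ from left to right, each upwards; after
reflection this is the reading $\mathrm{col}$ of $\mathscr G^x$. -/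
theorem keySink_lt_iff (hα : IsPeak α) {b c : ℕ × ℕ} (hb : b ∈ cd α) (hc : c ∈ cd α) :
    keySink b < keySink c ↔ gCol α b < gCol α c ∨ gCol α b = gCol α c ∧ b.2 < c.2 := by
  have hb' := (mem_cd _ _).mp hb
  have hc' := (mem_cd _ _).mp hc
  have h1 := gCol_of_le (α := α) (b := b)
  have h2 := gCol_of_le (α := α) (b := c)
  have h3 := length_lt_gCol hα hb
  have h4 := length_lt_gCol hα hc
  have h3' := add_two_le_gCol hα hb
  have h4' := add_two_le_gCol hα hc
  have h5 := gCol_row hα hb hc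
  have h6 := gCol_lt hα hc hb
  have h7 := gCol_lt hα hb hc
  rw [keySink_lt]
  omega

theorem mem_diagramG (hα : IsPeak α) {d : ℕ × ℕ} :
    d ∈ diagramG α ↔ ∃ b ∈ cd α, (gCol α b, b.2) = d := by
  obtain ⟨u, v⟩ := d
  have hbody : ∀ j, 1 ≤ j → j ≤ α.length → ((u, v) ∈ (if j = α.length then
      (Finset.Icc 1 (part α j)).image fun x => (j + x - 1, j)
      else {(j, j), (j + 1, j)} ∪
        (Finset.Icc 3 (part α j)).image fun x : ℕ => ((kShift α j + x).toNat, j)) ↔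
      v = j ∧ ∃ x, 1 ≤ x ∧ x ≤ part α j ∧ gCol α (x, j) = u) := by
    intro j hj hjl
    split_ifs with h
    · simp only [Finset.mem_image, Finset.mem_Icc, Prod.mk.injEq]
      -- In the top row the shift is $\ell-1$, so both branches of `gCol` give the same contiguous
      -- formula.
      have hx : ∀ x, gCol α (x, j) = j + x - 1 := by
        intro x
        simp only [gCol, h, kShift_length]
        split_ifs
        · rfl
        · omega
      constructor
      · rintro ⟨x, hx1, hx2, hx3⟩
        exact ⟨hx3.symm, x, hx1.1, hx1.2, (hx x).trans hx2⟩
      · rintro ⟨rfl, x, hx1, hx2, hx3⟩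
        exact ⟨x, ⟨hx1, hx2⟩, (hx x).symm.trans hx3, rfl⟩
    · have h2 := two_le_part hα hj (by omega)
      simp only [Finset.mem_union, Finset.mem_insert, Finset.mem_singleton, Finset.mem_image,
        Finset.mem_Icc, Prod.mk.injEq]
      constructor
      · rintro ((⟨rfl, rfl⟩ | ⟨rfl, rfl⟩) | ⟨x, h3, rfl, rfl⟩)
        · exact ⟨rfl, 1, by omega, by omega, by simp [gCol]⟩
        · exact ⟨rfl, 2, by omega, by omega, by simp [gCol]⟩
        · exact ⟨rfl, x, by omega, by omega, by rw [gCol, if_neg (by simp only; omega)]⟩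
      · rintro ⟨rfl, x, h3, h4, h5⟩
        by_cases h6 : x ≤ 2
        · rw [gCol, if_pos (by exact h6)] at h5
          simp only at h5
          left
          omega
        · rw [gCol, if_neg (by exact h6)] at h5
          exact Or.inr ⟨x, by omega, h5, rfl⟩
  rw [diagramG, Finset.mem_biUnion]
  constructor
  · rintro ⟨j, hj, h⟩
    rw [Finset.mem_Icc] at hj
    obtain ⟨rfl, x, h1, h2, h3⟩ := (hbody j hj.1 hj.2).mp h
    exact ⟨(x, v), (mem_cd _ _).mpr ⟨hj, h1, h2⟩, by rw [h3]⟩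
  · rintro ⟨⟨x, j⟩, hb, h⟩
    have hb' := (mem_cd _ _).mp hb
    simp only [Prod.mk.injEq] at h hb'
    exact ⟨j, Finset.mem_Icc.mpr hb'.1, (hbody j hb'.1.1 hb'.1.2).mpr
      ⟨h.2.symm, x, hb'.2.1, hb'.2.2, h.1⟩⟩

/-! ### Transfer to fillings of $\mathscr G^x$ -/

/-- The bijection between the boxes of the composition diagram and those of `𝒢`. -/
noncomputable def gEquiv (hα : IsPeak α) : {b // b ∈ cd α} ≃ {b // b ∈ diagramG α} :=
  Equiv.ofBijective (fun b => ⟨(gCol α b.1, b.1.2), (mem_diagramG hα).mpr ⟨b.1, b.2, rfl⟩⟩) ⟨by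
    intro b c h
    simp only [Subtype.mk.injEq, Prod.mk.injEq] at h
    exact Subtype.ext (((treeLE_iff hα b.2 c.2).mpr ⟨h.1.le, h.2.le⟩).antisymm
      ((treeLE_iff hα c.2 b.2).mpr ⟨h.1.ge, h.2.ge⟩)), by
    rintro ⟨d, hd⟩
    obtain ⟨b, hb, rfl⟩ := (mem_diagramG hα).mp hd
    exact ⟨⟨b, hb⟩, rfl⟩⟩

/-- The bijection between the boxes of the composition diagram and those of `𝒢^x`. -/
noncomputable def gxEquiv (hα : IsPeak α) :
    {b // b ∈ cd α} ≃ {b // b ∈ reflX (diagramG α)} :=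
  (gEquiv hα).trans (reflXEquiv (diagramG α))

theorem gxEquiv_fst (hα : IsPeak α) (b : {b // b ∈ cd α}) :
    (gxEquiv hα b).1.1 = gCol α b.1 := rfl

theorem gxEquiv_snd (hα : IsPeak α) (b : {b // b ∈ cd α}) :
    (gxEquiv hα b).1.2 = topRow (diagramG α) + 1 - b.1.2 := rfl

theorem snd_le_topRow (hα : IsPeak α) (b : {b // b ∈ cd α}) :
    b.1.2 ≤ topRow (diagramG α) :=
  show (gEquiv hα b).1.2 ≤ _ from Finset.le_sup (f := Prod.snd) (gEquiv hα b).2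

/-- The labeling of the boxes of the composition diagram by a filling of `𝒢^x`. -/
noncomputable def toLabeling (hα : IsPeak α) (T : Filling n (reflX (diagramG α))) :
    Filling n (cd α) := (gxEquiv hα).trans T

theorem isLabeling_toLabeling (hα : IsPeak α) (T : Filling n (reflX (diagramG α))) :
    IsLabeling (toLabeling hα T) ↔ ∀ b b' : {b // b ∈ reflX (diagramG α)},
      b.1.1 ≤ b'.1.1 → b.1.2 ≤ b'.1.2 → T b ≤ T b' := by
  rw [← (gxEquiv hα).forall_congr_right]
  refine forall_congr' fun b => ?_
  rw [← (gxEquiv hα).forall_congr_right]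
  refine forall_congr' fun c => ?_
  rw [labelLE_iff hα b.2 c.2, gxEquiv_fst, gxEquiv_fst, gxEquiv_snd, gxEquiv_snd]
  have h1 := snd_le_topRow hα b
  have h2 := snd_le_topRow hα c
  rw [and_imp, show topRow (diagramG α) + 1 - b.1.2 ≤ topRow (diagramG α) + 1 - c.1.2 ↔
    c.1.2 ≤ b.1.2 by omega]
  rfl

/-- Reflecting twice restores the vertical order of $\mathscr G$, whose south-west order is the tree
order. Only comparisons of rows matter, and the bounds by `topRow` keep the natural subtractions
from truncating. -/
theorem sigmaL_posetOf (hα : IsPeak α) (T : Filling n (reflX (diagramG α))) :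
    sigmaL (posetOf T.reflX) = linExt (toLabeling hα T) := by
  ext γ
  change (∀ i j, (T.reflX.symm i).1 ≤ (T.reflX.symm j).1 → γ i ≤ γ j) ↔ _
  rw [← (toLabeling hα T).forall_congr_right]
  refine forall_congr' fun b => ?_
  rw [← (toLabeling hα T).forall_congr_right]
  refine forall_congr' fun c => ?_
  have h : ∀ b, T.reflX.symm (toLabeling hα T b) =
      reflXEquiv (reflX (diagramG α)) (gxEquiv hα b) := by
    intro b
    simp [Filling.reflX, toLabeling]
  rw [h, h, treeLE_iff hα b.2 c.2]
  have h1 := snd_le_topRow hα b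
  have h2 := snd_le_topRow hα c
  have h3 : (gxEquiv hα b).1.2 ≤ topRow (reflX (diagramG α)) :=
    Finset.le_sup (f := Prod.snd) (gxEquiv hα b).2
  have h4 : (gxEquiv hα c).1.2 ≤ topRow (reflX (diagramG α)) :=
    Finset.le_sup (f := Prod.snd) (gxEquiv hα c).2
  refine imp_congr_left ?_
  change gCol α b.1 ≤ gCol α c.1 ∧ topRow (reflX (diagramG α)) + 1 - (gxEquiv hα b).1.2 ≤
    topRow (reflX (diagramG α)) + 1 - (gxEquiv hα c).1.2 ↔ _
  rw [gxEquiv_snd] at *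
  rw [gxEquiv_snd] at *
  omega

theorem weakL_readTBLR (hα : IsPeak α) (T U : Filling n (reflX (diagramG α))) :
    weakL (readTBLR T) (readTBLR U) ↔ ∀ b c, sinkF α b < sinkF α c →
      toLabeling hα T c < toLabeling hα T b → toLabeling hα U c < toLabeling hα U b := by
  change weakL ((fillBy keyTBLR keyTBLR_injective T.card_eq).symm.trans T)
    ((fillBy keyTBLR keyTBLR_injective T.card_eq).symm.trans U) ↔ _
  rw [weakL_word_iff, ← (gxEquiv hα).forall_congr_right]
  refine forall_congr' fun b => ?_
  rw [← (gxEquiv hα).forall_congr_right]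
  refine forall_congr' fun c => ?_
  refine imp_congr_left ?_
  rw [fillBy_lt_iff, sinkF, fillBy_lt_iff, keySink_lt_iff hα b.2 c.2, keyTBLR_lt, gxEquiv_fst,
    gxEquiv_fst, gxEquiv_snd, gxEquiv_snd]
  have h1 := snd_le_topRow hα b
  have h2 := snd_le_topRow hα c
  omega

theorem ST_le_iff (hα : IsPeak α) (T U : ST n (reflX (diagramG α))) :
    T ≤ U ↔ intervalLE (linExt (toLabeling hα T.1)) (linExt (toLabeling hα U.1)) := by
  rw [intervalLE_linExt ((isLabeling_toLabeling hα _).mpr T.2)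
    ((isLabeling_toLabeling hα _).mpr U.2)]
  exact weakL_readTBLR hα T.1 U.1

theorem eqClass_eq_sigmaL (hα : IsPeak α) : eqClass (sinkInterval α hα) =
    {J | ∃ T : ST n (reflX (diagramG α)), J = sigmaL (posetOf T.1.reflX)} := by
  rw [eqClass_sinkInterval]
  ext J
  constructor
  · rintro ⟨ω, hω, rfl⟩
    have h : toLabeling hα ((gxEquiv hα).symm.trans ω) = ω := by
      ext
      simp [toLabeling]
    refine ⟨⟨(gxEquiv hα).symm.trans ω, (isLabeling_toLabeling hα _).mp (by rwa [h])⟩, ?_⟩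
    rw [sigmaL_posetOf hα, h]
  · rintro ⟨T, rfl⟩
    exact ⟨_, (isLabeling_toLabeling hα _).mpr T.2, sigmaL_posetOf hα T.1⟩

/-- The tableau-to-interval map preserves and reflects the order, so it is injective by antisymmetry
on the tableau side; `≼` on the class is given only as a relation. -/
theorem nonempty_orderIso (hα : IsPeak α) :
    Nonempty (eqClass (sinkInterval α hα) ≃o ST n (reflX (diagramG α))) := by
  let f : ST n (reflX (diagramG α)) → eqClass (sinkInterval α hα) := fun T =>
    ⟨sigmaL (posetOf T.1.reflX), by rw [eqClass_eq_sigmaL]; exact ⟨T, rfl⟩⟩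
  have hf : ∀ T U, f T ≤ f U ↔ T ≤ U := by
    intro T U
    rw [ST_le_iff hα, ← sigmaL_posetOf hα, ← sigmaL_posetOf hα]
    rfl
  have hbij : Function.Bijective f := by
    constructor
    · intro T U h
      exact le_antisymm ((hf T U).mp (h ▸ (hf T T).mpr le_rfl))
        ((hf U T).mp (h ▸ (hf T T).mpr le_rfl))
    · rintro ⟨J, hJ⟩
      obtain ⟨T, rfl⟩ := (eqClass_eq_sigmaL hα ▸ hJ :)
      exact ⟨T, rfl⟩
  exact ⟨OrderIso.symm ⟨Equiv.ofBijective f hbij, fun {T U} => hf T U⟩⟩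

end PeakTab

theorem mainTheorem10 {n : ℕ} (hn : 0 < n) (α : Composition n) (hα : PeakTab.IsPeak α) :
    PeakTab.eqClass (PeakTab.sinkInterval α hα) =
      {J | ∃ T : PeakTab.ST n (PeakTab.reflX (PeakTab.diagramG α)),
        J = PeakTab.sigmaL (PeakTab.posetOf T.1.reflX)} ∧
    PeakTab.IsMinOf (PeakTab.sourceInterval α hα)
      (PeakTab.eqClass (PeakTab.sinkInterval α hα)) ∧
    PeakTab.IsMaxOf (PeakTab.sinkInterval α hα)
      (PeakTab.eqClass (PeakTab.sinkInterval α hα)) ∧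
    Nonempty (PeakTab.eqClass (PeakTab.sinkInterval α hα) ≃o
      PeakTab.ST n (PeakTab.reflX (PeakTab.diagramG α))) :=
  ⟨PeakTab.eqClass_eq_sigmaL hα, PeakTab.isMinOf_sourceInterval hα,
    PeakTab.isMaxOf_sinkInterval hα, PeakTab.nonempty_orderIso hα⟩
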